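/- Let $T^2=S^1\times S^1$ with $S^1=\mathbb{R}/2\pi\mathbb{Z}$, let $\mathrm{pr}:\mathbb{R}^2\to T^2$ be the projection, and let $E\to T^2$ be a smooth oriented real vector bundle of rank $4$ with a smooth positive-definite metric $h$ and a smooth connection $\nabla$ satisfying $\nabla h=0$. Fix a positively oriented orthonormal basis $(v_i)$ of $E_{\mathrm{pr}(0,0)}$. Let $\xi_{i,x}$, $\xi_{i,y}$ be the $\nabla$-parallel sections of $\mathrm{pr}^*E$ along the lines $\{(x,0)\}$, $\{(0,y)\}$ with value $v_i$ at $(0,0)$, and let $A_1,A_2\in SO(4)$ be the matrices with $$(\xi_{1,x}\,\cdots\,\xi_{4,x})(a+2\pi,0)=(\xi_{1,x}\,\cdots\,\xi_{4,x})(a,0)\,A_1,\qquad (\xi_{1,y}\,\cdots\,\xi_{4,y})(0,b+2\pi)=(\xi_{1,y}\,\cdots\,\xi_{4,y})(0,b)\,A_2$$ for all $a,b\in\mathbb{R}$. The topological holonomy group $G_\nabla\subset SO(4)$ is the subgroup generated by $A_1$ and $A_2$; it is well defined up to conjugation in $SO(4)$. For $\varepsilon\in\{+,-\}$ let $\bigwedge^2_\varepsilon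 E\subset\bigwedge^2E$ be the rank $3$ subbundle with the local orthonormal frames $\frac1{\sqrt2}(e_1\wedge e_2+\varepsilon\, e_3\wedge e_4)$, $\frac1{\sqrt2}(e_1\wedge e_3+\varepsilon\, e_4\wedge e_2)$, $\frac1{\sqrt2}(e_1\wedge e_4+\varepsilon\, e_2\wedge e_3)$, where $(e_1,\dots,e_4)$ runs over the positively oriented local orthonormal frames of $E$; these frames define its orientation, and $\nabla$ induces a metric connection $\hat\nabla$ on it. Let $C_{\varepsilon,1},C_{\varepsilon,2}\in SO(3)$ be the matrices obtained from $(\bigwedge^2_\varepsilon E,\hat\nabla)$ and a positively oriented orthonormal basis of its fibre at $\mathrm{pr}(0,0)$ in the same way as $A_1,A_2$ are obtained from $(E,\nabla)$ and $(v_i)$. For $\varepsilon\in\{+,-\}$ and $k\in\{1,2\}$ suppose that $C_{\varepsilon,k}$ is the rotation by the angle $\theta_{\varepsilon,k}$ about a unit vector $p_{\varepsilon,k}\in\mathbb{R}^3$, that is, $C_{\varepsilon,k}=V\,C(\theta_{\varepsilon,k})\,{}^tV$ with $V\in SO(3)$ whose first column is $p_{\varepsilon,k}$ and $$C(\theta)=\begin{bmatrix}1&0&0\\0&\cos\theta&-\sin\theta\\0&\sin\theta&\cos\theta\end{bmatrix},$$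 and let $\phi_\varepsilon$ be the angle between $p_{\varepsilon,1}$ and $p_{\varepsilon,2}$. Suppose that $$\theta_{+,1}=q_1\pi,\quad \theta_{+,2}=\psi_2\pi,\quad \theta_{-,1}=\psi_1\pi,\quad \theta_{-,2}=q_2\pi,\quad \phi_+,\phi_-\in(0,\pi/2]$$ with $q_1,q_2\in\mathbb{Q}\setminus\mathbb{Z}$ and $\psi_1,\psi_2\in\mathbb{R}\setminus\mathbb{Q}$. Then $G_\nabla$ is dense in $SO(4)$. -/

import Mathlib

open scoped Manifold ContDiff Topology Bundle Real

noncomputable section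

namespace TorusHolonomy

/-! ### Two-forms on an oriented four-dimensional Euclidean space -/

section Fiber

variable {V : Type*} [NormedAddCommGroup V] [InnerProductSpace ℝ V]

/-- The decomposable bivector `a ∧ b`. -/
def wedge (a b : V) : ⋀[ℝ]^2 V := exteriorPower.ιMulti ℝ 2 ![a, b]

/-- For `ε = ±1` and a basis `e = (e₁, e₂, e₃, e₄)`, the three bivectors
`(e₁ ∧ e₂ + ε e₃ ∧ e₄) / √2`, `(e₁ ∧ e₃ + ε e₄ ∧ e₂) / √2`, `(e₁ ∧ e₄ + ε e₂ ∧ e₃) / √2`. -/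
def twistorFrame (ε : ℤˣ) (e : OrthonormalBasis (Fin 4) ℝ V) : Fin 3 → ⋀[ℝ]^2 V :=
  ![(1 / √2 : ℝ) • (wedge (e 0) (e 1) + ((ε : ℤ) : ℝ) • wedge (e 2) (e 3)),
    (1 / √2 : ℝ) • (wedge (e 0) (e 2) + ((ε : ℤ) : ℝ) • wedge (e 3) (e 1)),
    (1 / √2 : ℝ) • (wedge (e 0) (e 3) + ((ε : ℤ) : ℝ) • wedge (e 1) (e 2))]

/-- The subspace `⋀²_ε V` of (anti-)self-dual bivectors, spanned by the bivectors `twistorFrame ε e`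
of the positively oriented orthonormal bases `e`. -/
def selfDual (o : Orientation ℝ V (Fin 4)) (ε : ℤˣ) : Submodule ℝ (⋀[ℝ]^2 V) :=
  Submodule.span ℝ {w | ∃ e : OrthonormalBasis (Fin 4) ℝ V, e.toBasis.orientation = o ∧
    ∃ i, w = twistorFrame ε e i}

variable [FiniteDimensional ℝ V]

/-- The unit sphere of `⋀²_ε V`, for the inner product of `⋀² V` induced by that of `V`. -/
def twistorSphere (o : Orientation ℝ V (Fin 4)) (ε : ℤˣ) : Set (⋀[ℝ]^2 V) :=
  {w | w ∈ selfDual o ε ∧ ‖w‖ = 1}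

/-- `w` is an orthonormal basis of `⋀²_ε V` that gives the orientation of `⋀²_ε V`, which is the
one given by the frames `twistorFrame ε e`. -/
structure IsOrientedTwistorBasis (o : Orientation ℝ V (Fin 4)) (ε : ℤˣ)
    (w : Fin 3 → ⋀[ℝ]^2 V) : Prop where
  mem : ∀ i, w i ∈ selfDual o ε
  orthonormal : Orthonormal ℝ w
  orientation : ∀ e : OrthonormalBasis (Fin 4) ℝ V, e.toBasis.orientation = o →
    0 < (Matrix.of fun i j => inner ℝ (twistorFrame ε e i) (w j)).det

end Fiber

/-! ### The torus, and covariant differentiation along curves in it -/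

/-- The torus `T² = S¹ × S¹`. -/
abbrev Torus : Type := Circle × Circle

/-- The model with corners of the torus. -/
abbrev IT := (𝓡 1).prod (𝓡 1)

/-- The model fibre of a real vector bundle of rank `4`. -/
abbrev R4 := EuclideanSpace ℝ (Fin 4)

/-- The standard projection `ℝ² → T²`; its group of periods is `2πℤ × 2πℤ`. -/
def pr (p : ℝ × ℝ) : Torus := (Circle.exp p.1, Circle.exp p.2)

/-- The image in the torus of the line `l_x`. -/
abbrev curveX (t : ℝ) : Torus := pr (t, 0)

/-- The image in the torus of the line `l_y`. -/
abbrev curveY (t : ℝ) : Torus := pr (0, t)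

/-- The velocity of a curve in the torus. -/
def velocity (c : ℝ → Torus) (t : ℝ) : TangentSpace IT (c t) :=
  mfderiv 𝓘(ℝ, ℝ) IT c t (1 : ℝ)

/-- A family of sections `ξ₁, …, ξₙ` along a curve `c` of period `2π` satisfies
`(ξ₁(a+2π) … ξₙ(a+2π)) = (ξ₁(a) … ξₙ(a)) A` for all `a`. The fibres at `c (a + 2π)` and `c a` are
the same fibre, as expressed by the equality in the disjoint union of the fibres. -/
def HasMonodromy {G : Torus → Type*} [∀ b, AddCommGroup (G b)] [∀ b, Module ℝ (G b)]
    {n : ℕ} {c : ℝ → Torus} (ξ : Fin n → ∀ t, G (c t)) (A : Matrix (Fin n) (Fin n) ℝ) : Prop :=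
  ∀ (a : ℝ) (j : Fin n),
    (⟨c (a + 2 * π), ξ j (a + 2 * π)⟩ : Σ b, G b) = ⟨c a, ∑ i, A i j • ξ i a⟩

section Bundle

variable {E : Torus → Type*} [TopologicalSpace (Bundle.TotalSpace R4 E)]
  [∀ b, NormedAddCommGroup (E b)] [∀ b, InnerProductSpace ℝ (E b)] [FiberBundle R4 E]

/-- A choice of orientations of the fibres is an orientation of the bundle if around each point
there is a smooth frame that is positively oriented. -/
def IsBundleOrientation (o : ∀ b, Orientation ℝ (E b) (Fin 4)) : Prop :=
  ∀ b, ∃ u ∈ 𝓝 b, ∃ (s : Fin 4 → ∀ x, E x) (hs : IsLocalFrameOn IT R4 ∞ s u),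
    ∀ (x : Torus) (hx : x ∈ u), (hs.toBasisAt hx).orientation = o x

/-- `v` is the covariant derivative at time `t`, for the pull-back of the connection `nabla` by
`c`, of the section `ξ` along `c`: near `t` one can write `ξ = ∑ᵢ fᵢ (sᵢ ∘ c)` with functions `fᵢ`
and local sections `sᵢ` of the bundle, and `v = ∑ᵢ (fᵢ' sᵢ + fᵢ ∇_{c'} sᵢ)`. -/
def HasCovDerivAlongAt (nabla : CovariantDerivative IT R4 E) (c : ℝ → Torus)
    (ξ : ∀ t, E (c t)) (t : ℝ) (v : E (c t)) : Prop :=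
  ∃ (n : ℕ) (f : Fin n → ℝ → ℝ) (s : Fin n → ∀ b, E b),
    (∀ i, DifferentiableAt ℝ (f i) t) ∧
    (∀ i, ContMDiffAt IT (IT.prod 𝓘(ℝ, R4)) ∞
      (fun b => Bundle.TotalSpace.mk' R4 b (s i b)) (c t)) ∧
    (∀ᶠ τ in 𝓝 t, ξ τ = ∑ i, f i τ • s i (c τ)) ∧
    v = ∑ i, (deriv (f i) t • s i (c t) + f i t • nabla (s i) (c t) (velocity c t))

/-- `w` is the covariant derivative at time `t` of the section `Ω` of `⋀² E` along `c`, for the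
connection of `⋀² E` induced by `nabla`: near `t` one can write `Ω = ∑ₖ aₖ ∧ bₖ`, and
`w = ∑ₖ (∇aₖ ∧ bₖ + aₖ ∧ ∇bₖ)`. -/
def HasCovDerivAlongAt₂ (nabla : CovariantDerivative IT R4 E) (c : ℝ → Torus)
    (Ω : ∀ t, ⋀[ℝ]^2 (E (c t))) (t : ℝ) (w : ⋀[ℝ]^2 (E (c t))) : Prop :=
  ∃ (n : ℕ) (a b : Fin n → ∀ τ, E (c τ)) (a' b' : Fin n → E (c t)),
    (∀ k, HasCovDerivAlongAt nabla c (a k) t (a' k)) ∧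
    (∀ k, HasCovDerivAlongAt nabla c (b k) t (b' k)) ∧
    (∀ᶠ τ in 𝓝 t, Ω τ = ∑ k, wedge (a k τ) (b k τ)) ∧
    w = ∑ k, (wedge (a' k) (b k t) + wedge (a k t) (b' k))

/-- The section `ξ` of `E` along `c` is parallel. -/
def IsParallelAlong (nabla : CovariantDerivative IT R4 E) (c : ℝ → Torus)
    (ξ : ∀ t, E (c t)) : Prop :=
  ∀ t, HasCovDerivAlongAt nabla c ξ t 0

/-- `Ω` is a section along `c` of the twistor space (the bundle of unit spheres in `⋀²_ε E`) which
is horizontal for the connection induced by `nabla`. -/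
def IsHorizontalAlong [∀ b, FiniteDimensional ℝ (E b)] (nabla : CovariantDerivative IT R4 E)
    (o : ∀ b, Orientation ℝ (E b) (Fin 4)) (ε : ℤˣ) (c : ℝ → Torus)
    (Ω : ∀ t, ⋀[ℝ]^2 (E (c t))) : Prop :=
  ∀ t, Ω t ∈ twistorSphere (o (c t)) ε ∧ HasCovDerivAlongAt₂ nabla c Ω t 0

/-! ### Topological holonomy groups -/

/-- `A₁, A₂ ∈ SO(4)` are the matrices, with respect to some positively oriented orthonormal basis of
the fibre at `pr (0, 0)`, of the parallel transports of `nabla` along the two standard circles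
through `pr (0, 0)`. -/
def IsHolonomyPair (nabla : CovariantDerivative IT R4 E) (o : ∀ b, Orientation ℝ (E b) (Fin 4))
    (A₁ A₂ : Matrix.specialOrthogonalGroup (Fin 4) ℝ) : Prop :=
  ∃ (v : OrthonormalBasis (Fin 4) ℝ (E (pr (0, 0))))
    (ξx : Fin 4 → ∀ t, E (curveX t)) (ξy : Fin 4 → ∀ t, E (curveY t)),
    v.toBasis.orientation = o (pr (0, 0)) ∧
    (∀ i, IsParallelAlong nabla curveX (ξx i) ∧ ξx i 0 = v i) ∧
    (∀ i, IsParallelAlong nabla curveY (ξy i) ∧ ξy i 0 = v i) ∧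
    HasMonodromy ξx A₁.1 ∧ HasMonodromy ξy A₂.1

/-- `G` is the topological holonomy group of `nabla` at `pr (0, 0)` (which is determined up to
conjugation in `SO(4)`, by the choice of the basis): the subgroup generated by `A₁`, `A₂`. -/
def IsTopHolonomyGroup (nabla : CovariantDerivative IT R4 E)
    (o : ∀ b, Orientation ℝ (E b) (Fin 4))
    (G : Subgroup (Matrix.specialOrthogonalGroup (Fin 4) ℝ)) : Prop :=
  ∃ A₁ A₂, IsHolonomyPair nabla o A₁ A₂ ∧ G = Subgroup.closure {A₁, A₂}

/-- `C₁, C₂ ∈ SO(3)` are the matrices, with respect to some positively oriented orthonormal basis of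
the fibre of `⋀²_ε E` at `pr (0, 0)`, of the parallel transports of the connection induced by
`nabla` along the two standard circles through `pr (0, 0)`; they generate the topological holonomy
group of that connection in `⋀²_ε E`. -/
def IsTwistorHolonomyPair [∀ b, FiniteDimensional ℝ (E b)] (nabla : CovariantDerivative IT R4 E)
    (o : ∀ b, Orientation ℝ (E b) (Fin 4)) (ε : ℤˣ)
    (C₁ C₂ : Matrix.specialOrthogonalGroup (Fin 3) ℝ) : Prop :=
  ∃ (w : Fin 3 → ⋀[ℝ]^2 (E (pr (0, 0))))
    (Ωx : Fin 3 → ∀ t, ⋀[ℝ]^2 (E (curveX t))) (Ωy : Fin 3 → ∀ t, ⋀[ℝ]^2 (E (curveY t))),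
    IsOrientedTwistorBasis (o (pr (0, 0))) ε w ∧
    (∀ i, IsHorizontalAlong nabla o ε curveX (Ωx i) ∧ Ωx i 0 = w i) ∧
    (∀ i, IsHorizontalAlong nabla o ε curveY (Ωy i) ∧ Ωy i 0 = w i) ∧
    HasMonodromy (G := fun b => ⋀[ℝ]^2 (E b)) Ωx C₁.1 ∧
    HasMonodromy (G := fun b => ⋀[ℝ]^2 (E b)) Ωy C₂.1

end Bundle

/-! ### Rotations of three-dimensional space -/

/-- The rotation `C(θ)` about the first coordinate axis. -/
def rotMatrix (θ : ℝ) : Matrix (Fin 3) (Fin 3) ℝ :=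
  !![1, 0, 0; 0, Real.cos θ, -Real.sin θ; 0, Real.sin θ, Real.cos θ]

/-- `C` is the rotation with angle `θ` about the unit vector `p`: one has `C = V C(θ) ᵗV` for some
`V ∈ SO(3)` with first column `p`. -/
def IsRotation (C : Matrix.specialOrthogonalGroup (Fin 3) ℝ) (θ : ℝ)
    (p : EuclideanSpace ℝ (Fin 3)) : Prop :=
  ∃ V : Matrix.specialOrthogonalGroup (Fin 3) ℝ,
    C.1 = V.1 * rotMatrix θ * V.1.transpose ∧ ∀ i, p i = V.1 i 0

end TorusHolonomy

end

open TorusHolonomy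

noncomputable section

namespace TorusHolonomy

/-! ### Quaternion multiplications and the double cover of SO(4) -/

open Quaternion Matrix

/-! Identify ℝ⁴ with the quaternions. Every rotation is `x ↦ a * x * star b` with unit `a`, `b`
(`isSandwich_of_det_eq_one`), so write A_k = L(a_k) R(b_k). As skew matrices, the self-dual
bivectors are the left multiplications by pure quaternions and the anti-self-dual ones are the right
multiplications; conjugation by A_k acts on the former through a_k alone and on the latter through
b_k alone. Since parallel transport on bivectors is induced by that on E, C_{+,k} is conjugation by
a_k and C_{-,k} is conjugation by b_k, in bases common to k = 1, 2 (`exists_isConjMatrix`).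

A rational angle makes a₁ and b₂ of finite order (`exists_pow_eq_one_of_isRotation`), so a power of
A₁ is a pure right multiplication R(b₁^N), and a power of A₂ is a pure left multiplication L(a₂^M).
The irrational angles of a₂ and b₁ make the closure of G contain the whole circles through these
powers (`containsCircle_of_irrational`).

Conjugation by A₁ carries the circle on the left to one about the axis of a₂ turned by a₁. As the
two axes are not parallel and q₁ is not an integer, this is a different circle
(`IsRotation.mulVec_ne`). Two different circles generate all unit quaternions (`mem_of_circles`), so
the closure contains every left multiplication by a unit quaternion. The same argument with A₂ gives
every right multiplication, hence all of SO(4) (`mem_of_isRotation_pairs`). -/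

/-- The matrix of `x ↦ a * x` in the basis `1, i, j, k` of the quaternions. -/
def leftMatrix (a : ℍ[ℝ]) : Matrix (Fin 4) (Fin 4) ℝ :=
  !![a.re, -a.imI, -a.imJ, -a.imK; a.imI, a.re, -a.imK, a.imJ;
    a.imJ, a.imK, a.re, -a.imI; a.imK, -a.imJ, a.imI, a.re]

/-- The matrix of `x ↦ x * star b` in the basis `1, i, j, k` of the quaternions. -/
def rightMatrix (b : ℍ[ℝ]) : Matrix (Fin 4) (Fin 4) ℝ :=
  !![b.re, b.imI, b.imJ, b.imK; -b.imI, b.re, -b.imK, b.imJ;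
    -b.imJ, b.imK, b.re, -b.imI; -b.imK, -b.imJ, b.imI, b.re]

theorem leftMatrix_mul (a b : ℍ[ℝ]) : leftMatrix (a * b) = leftMatrix a * leftMatrix b := by
  ext i j
  fin_cases i <;> fin_cases j <;>
    simp [leftMatrix, Matrix.mul_apply, Fin.sum_univ_four] <;> ring

/-- The `star` in `x ↦ x * star b` is what makes right multiplication a homomorphism instead of an
anti-homomorphism. -/
theorem rightMatrix_mul (a b : ℍ[ℝ]) : rightMatrix (a * b) = rightMatrix a * rightMatrix b := by
  ext i j
  fin_cases i <;> fin_cases j <;>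
    simp [rightMatrix, Matrix.mul_apply, Fin.sum_univ_four] <;> ring

theorem leftMatrix_mul_rightMatrix_comm (a b : ℍ[ℝ]) :
    leftMatrix a * rightMatrix b = rightMatrix b * leftMatrix a := by
  ext i j
  fin_cases i <;> fin_cases j <;>
    simp [leftMatrix, rightMatrix, Matrix.mul_apply, Fin.sum_univ_four] <;> ring

theorem leftMatrix_one : leftMatrix 1 = 1 := by
  ext i j
  fin_cases i <;> fin_cases j <;> simp [leftMatrix]

theorem rightMatrix_one : rightMatrix 1 = 1 := by
  ext i j
  fin_cases i <;> fin_cases j <;> simp [rightMatrix]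

theorem leftMatrix_star (a : ℍ[ℝ]) : leftMatrix (star a) = (leftMatrix a)ᵀ := by
  ext i j
  fin_cases i <;> fin_cases j <;> simp [leftMatrix]

theorem rightMatrix_star (a : ℍ[ℝ]) : rightMatrix (star a) = (rightMatrix a)ᵀ := by
  ext i j
  fin_cases i <;> fin_cases j <;> simp [rightMatrix]

theorem leftMatrix_pow (a : ℍ[ℝ]) (n : ℕ) : leftMatrix (a ^ n) = leftMatrix a ^ n := by
  induction n with
  | zero => simp [leftMatrix_one]
  | succ n ih => rw [pow_succ, pow_succ, leftMatrix_mul, ih]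

theorem rightMatrix_pow (a : ℍ[ℝ]) (n : ℕ) : rightMatrix (a ^ n) = rightMatrix a ^ n := by
  induction n with
  | zero => simp [rightMatrix_one]
  | succ n ih => rw [pow_succ, pow_succ, rightMatrix_mul, ih]

theorem det_leftMatrix (a : ℍ[ℝ]) : (leftMatrix a).det = normSq a ^ 2 := by
  simp [leftMatrix, Matrix.det_succ_row_zero, Fin.sum_univ_succ, normSq_def', Fin.succAbove]
  ring

theorem det_rightMatrix (a : ℍ[ℝ]) : (rightMatrix a).det = normSq a ^ 2 := by
  simp [rightMatrix, Matrix.det_succ_row_zero, Fin.sum_univ_succ, normSq_def', Fin.succAbove]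
  ring

theorem leftMatrix_star_mul_self {a : ℍ[ℝ]} (ha : normSq a = 1) :
    leftMatrix (star a) * leftMatrix a = 1 := by
  rw [← leftMatrix_mul, star_mul_self, ha, coe_one, leftMatrix_one]

theorem rightMatrix_star_mul_self {a : ℍ[ℝ]} (ha : normSq a = 1) :
    rightMatrix (star a) * rightMatrix a = 1 := by
  rw [← rightMatrix_mul, star_mul_self, ha, coe_one, rightMatrix_one]

theorem sandwich_mul (a b c d : ℍ[ℝ]) :
    leftMatrix a * rightMatrix b * (leftMatrix c * rightMatrix d) =
      leftMatrix (a * c) * rightMatrix (b * d) := by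
  rw [leftMatrix_mul, rightMatrix_mul, mul_assoc, ← mul_assoc (rightMatrix b),
    ← leftMatrix_mul_rightMatrix_comm]
  simp only [mul_assoc]

/-- A matrix that is the product of a left and a right multiplication by unit quaternions. -/
def IsSandwich (A : Matrix (Fin 4) (Fin 4) ℝ) : Prop :=
  ∃ a b : ℍ[ℝ], normSq a = 1 ∧ normSq b = 1 ∧ A = leftMatrix a * rightMatrix b

theorem IsSandwich.mul {A B : Matrix (Fin 4) (Fin 4) ℝ} (hA : IsSandwich A) (hB : IsSandwich B) :
    IsSandwich (A * B) := by
  obtain ⟨a, b, ha, hb, rfl⟩ := hA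
  obtain ⟨c, d, hc, hd, rfl⟩ := hB
  exact ⟨a * c, b * d, by simp [ha, hc], by simp [hb, hd], sandwich_mul a b c d⟩

/-- Allows a rotation to be normalised step by step, first to fix 1 and then to fix i. -/
theorem IsSandwich.of_mul_left {a b : ℍ[ℝ]} (ha : normSq a = 1) (hb : normSq b = 1)
    {A : Matrix (Fin 4) (Fin 4) ℝ} (h : IsSandwich (leftMatrix a * rightMatrix b * A)) :
    IsSandwich A := by
  have h' : IsSandwich (leftMatrix (star a) * rightMatrix (star b)) :=
    ⟨_, _, by simpa, by simpa, rfl⟩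
  convert h'.mul h using 1
  rw [← mul_assoc, sandwich_mul, star_mul_self, star_mul_self, ha, hb, coe_one, leftMatrix_one,
    rightMatrix_one, one_mul, one_mul]

/-- The quaternion `a + b i + c j + d k`. -/
def quat (a b c d : ℝ) : ℍ[ℝ] := ⟨a, b, c, d⟩

section

variable (a b c d : ℝ)

@[simp] theorem re_quat : (quat a b c d).re = a := rfl

@[simp] theorem imI_quat : (quat a b c d).imI = b := rfl

@[simp] theorem imJ_quat : (quat a b c d).imJ = c := rfl

@[simp] theorem imK_quat : (quat a b c d).imK = d := rfl

theorem normSq_quat : normSq (quat a b c d) = a ^ 2 + b ^ 2 + c ^ 2 + d ^ 2 := normSq_def' _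

end

/-- A unit pure quaternion is conjugate to `i`. -/
theorem exists_conj_eq_i {p : ℍ[ℝ]} (hp : normSq p = 1) (hre : p.re = 0) :
    ∃ g : ℍ[ℝ], normSq g = 1 ∧ g * p * star g = quat 0 1 0 0 := by
  rw [normSq_def', hre] at hp
  by_cases h : 1 + p.imI = 0
  · have h1 : p.imI = -1 := by linarith
    rw [h1] at hp
    have h2 : p.imJ = 0 := by nlinarith
    have h3 : p.imK = 0 := by nlinarith
    -- Here p = -i, the case in which 1 - i p vanishes; j conjugates -i to i.
    refine ⟨quat 0 0 1 0, by simp [normSq_quat], ?_⟩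
    ext <;> simp [hre, h1, h2, h3]
  · have hpos : 0 < 1 + p.imI := by
      have : -1 ≤ p.imI := by nlinarith
      rcases this.lt_or_eq with h' | h'
      · linarith
      · exact absurd (by linarith) h
    obtain ⟨r, hr⟩ : ∃ r : ℝ, r ^ 2 * (2 * (1 + p.imI)) = 1 := by
      refine ⟨(√(2 * (1 + p.imI)))⁻¹, ?_⟩
      rw [inv_pow, Real.sq_sqrt (by positivity)]
      field_simp
    -- This is r (1 - i p): since p² = -1, (1 - i p) p = p + i = i (1 - i p).
    refine ⟨quat (r * (1 + p.imI)) 0 (r * p.imK) (-(r * p.imJ)), ?_, ?_⟩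
    · rw [normSq_quat]
      linear_combination hr + r ^ 2 * hp
    · ext <;> simp [hre]
      · ring
      · linear_combination hr + r ^ 2 * (2 + p.imI) * hp
      · linear_combination (- r ^ 2 * p.imJ) * hp
      · linear_combination (- r ^ 2 * p.imK) * hp

theorem exists_cos_sin {x y : ℝ} (h : x ^ 2 + y ^ 2 = 1) :
    ∃ t, Real.cos t = x ∧ Real.sin t = y := by
  have hz : ‖(⟨x, y⟩ : ℂ)‖ = 1 := by
    rw [Complex.norm_def, Complex.normSq_apply]
    simp [← sq, h]
  obtain ⟨θ, hθ⟩ := (Complex.norm_eq_one_iff _).1 hz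
  exact ⟨θ, by rw [← Complex.exp_ofReal_mul_I_re, hθ], by rw [← Complex.exp_ofReal_mul_I_im, hθ]⟩

theorem exists_half_angle {x y : ℝ} (h : x ^ 2 + y ^ 2 = 1) :
    ∃ s t : ℝ, s ^ 2 + t ^ 2 = 1 ∧ s ^ 2 - t ^ 2 = x ∧ 2 * s * t = y := by
  obtain ⟨θ, hx, hy⟩ := exists_cos_sin h
  refine ⟨Real.cos (θ / 2), Real.sin (θ / 2), Real.cos_sq_add_sin_sq _, ?_, ?_⟩
  · rw [← Real.cos_two_mul', ← hx]; ring_nf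
  · rw [← hy, mul_right_comm, ← Real.sin_two_mul]; ring_nf

/-- Only the plane of j and k is turned, and conjugation by the point s + t i of half the angle does
exactly this. -/
theorem isSandwich_of_fixes_two {A : Matrix (Fin 4) (Fin 4) ℝ} (hA : Aᵀ * A = 1)
    (hdet : A.det = 1) (h0 : ∀ i, A i 0 = if i = 0 then 1 else 0)
    (h1 : ∀ i, A i 1 = if i = 1 then 1 else 0) : IsSandwich A := by
  have e (i j : Fin 4) := congrFun (congrFun hA i) j
  simp only [Matrix.mul_apply, Fin.sum_univ_four, Matrix.transpose_apply] at e
  have a02 : A 0 2 = 0 := by simpa [h0] using e 0 2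
  have a03 : A 0 3 = 0 := by simpa [h0] using e 0 3
  have a12 : A 1 2 = 0 := by simpa [h1] using e 1 2
  have a13 : A 1 3 = 0 := by simpa [h1] using e 1 3
  have n2 := e 2 2
  have n3 := e 3 3
  have o23 := e 2 3
  have hd : A 2 2 * A 3 3 - A 2 3 * A 3 2 = 1 := by
    rw [← hdet]
    simp [Matrix.det_succ_row_zero, Fin.sum_univ_succ, Fin.succAbove, h0, h1, a12, a13]
    ring
  simp [a02, a12, a03, a13] at n2 n3 o23
  -- An orthogonal 2 × 2 block of determinant 1 equals its cofactor matrix.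
  have h33 : A 3 3 = A 2 2 := by linear_combination A 2 2 * hd - A 3 3 * n2 + A 3 2 * o23
  have h23 : A 2 3 = - A 3 2 := by linear_combination - A 3 2 * hd - A 2 3 * n2 + A 2 2 * o23
  obtain ⟨s, t, hst, hx, hy⟩ := exists_half_angle (x := A 2 2) (y := A 3 2) (by linarith)
  refine ⟨quat s t 0 0, quat s t 0 0, by rw [normSq_quat]; linarith,
    by rw [normSq_quat]; linarith, ?_⟩
  ext i j
  fin_cases i <;> fin_cases j <;>
    simp [leftMatrix, rightMatrix, Matrix.mul_apply, Fin.sum_univ_four, h0, h1, a02, a03, a12, a13,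
      h33, h23] <;> linarith

/-- The image of i is a unit pure quaternion; composing with a conjugation that takes it back to i
leaves a rotation fixing both 1 and i. -/
theorem isSandwich_of_fixes_one {A : Matrix (Fin 4) (Fin 4) ℝ} (hA : Aᵀ * A = 1)
    (hdet : A.det = 1) (h0 : ∀ i, A i 0 = if i = 0 then 1 else 0) : IsSandwich A := by
  have e (i j : Fin 4) := congrFun (congrFun hA i) j
  simp only [Matrix.mul_apply, Fin.sum_univ_four, Matrix.transpose_apply] at e
  have a01 : A 0 1 = 0 := by simpa [h0] using e 0 1
  have n1 := e 1 1
  simp [a01] at n1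
  obtain ⟨g, hg, hconj⟩ := exists_conj_eq_i (p := quat 0 (A 1 1) (A 2 1) (A 3 1))
    (by rw [normSq_quat]; linarith) rfl
  refine IsSandwich.of_mul_left hg hg (isSandwich_of_fixes_two ?_ ?_ ?_ ?_)
  · have h : (leftMatrix g * rightMatrix g)ᵀ * (leftMatrix g * rightMatrix g) = 1 := by
      rw [Matrix.transpose_mul, ← leftMatrix_star, ← rightMatrix_star, mul_assoc,
        ← mul_assoc (leftMatrix _), leftMatrix_star_mul_self hg, one_mul,
        rightMatrix_star_mul_self hg]
    rw [Matrix.transpose_mul, mul_assoc, ← mul_assoc _ _ A, h, one_mul, hA]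
  · simp [Matrix.det_mul, det_leftMatrix, det_rightMatrix, hg, hdet]
  · rw [normSq_def'] at hg
    intro i
    simp only [Matrix.mul_apply (M := leftMatrix g * rightMatrix g), h0]
    fin_cases i <;>
    simp [leftMatrix, rightMatrix, Matrix.mul_apply, Fin.sum_univ_four] <;> linarith
  · have c0 := congrArg QuaternionAlgebra.re hconj
    have c1 := congrArg QuaternionAlgebra.imI hconj
    have c2 := congrArg QuaternionAlgebra.imJ hconj
    have c3 := congrArg QuaternionAlgebra.imK hconj
    simp at c0 c1 c2 c3
    intro i
    fin_cases i <;>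
    simp [leftMatrix, rightMatrix, Matrix.mul_apply, Fin.sum_univ_four, a01] <;> linarith

/-- Every rotation of the quaternions has the form `x ↦ a * x * star b`. -/
theorem isSandwich_of_det_eq_one {A : Matrix (Fin 4) (Fin 4) ℝ} (hA : Aᵀ * A = 1)
    (hdet : A.det = 1) : IsSandwich A := by
  have e := congrFun (congrFun hA 0) 0
  simp only [Matrix.mul_apply, Fin.sum_univ_four, Matrix.transpose_apply, Matrix.one_apply_eq] at e
  have hu : normSq (star (quat (A 0 0) (A 1 0) (A 2 0) (A 3 0))) = 1 := by
    rw [normSq_star, normSq_quat]; linarith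
  -- Left multiplication by the conjugate of the image of 1 brings that image back to 1.
  refine IsSandwich.of_mul_left hu (map_one normSq) (isSandwich_of_fixes_one ?_ ?_ ?_) <;>
    rw [rightMatrix_one, mul_one]
  · rw [Matrix.transpose_mul, mul_assoc, ← mul_assoc _ _ A, ← leftMatrix_star,
      leftMatrix_star_mul_self hu, one_mul, hA]
  · rw [Matrix.det_mul, det_leftMatrix, hu, hdet, one_pow, one_mul]
  · intro i
    fin_cases i <;> simp [leftMatrix, Matrix.mul_apply, Fin.sum_univ_four] <;> linarith

/-! ### Circles in the unit quaternions and what they generate -/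

/-- The point `cos t + sin t u` of the circle through `1` and `u`. -/
def circlePoint (u : ℍ[ℝ]) (t : ℝ) : ℍ[ℝ] := (Real.cos t : ℍ[ℝ]) + Real.sin t • u

section

variable (u : ℍ[ℝ]) (t : ℝ)

@[simp] theorem re_circlePoint : (circlePoint u t).re = Real.cos t + Real.sin t * u.re := by
  simp [circlePoint]

@[simp] theorem imI_circlePoint : (circlePoint u t).imI = Real.sin t * u.imI := by
  simp [circlePoint]

@[simp] theorem imJ_circlePoint : (circlePoint u t).imJ = Real.sin t * u.imJ := by
  simp [circlePoint]

@[simp] theorem imK_circlePoint : (circlePoint u t).imK = Real.sin t * u.imK := by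
  simp [circlePoint]

theorem circlePoint_zero : circlePoint u 0 = 1 := by simp [circlePoint]

theorem circlePoint_neg_left : circlePoint (-u) t = circlePoint u (-t) := by
  ext <;> simp

theorem continuous_circlePoint : Continuous (circlePoint u) :=
  (continuous_coe.comp Real.continuous_cos).add (Real.continuous_sin.smul continuous_const)

end

theorem mul_self_of_pure {u : ℍ[ℝ]} (hu : normSq u = 1) (hre : u.re = 0) : u * u = -1 := by
  have := self_mul_star u
  rw [star_eq_neg.2 hre, hu, mul_neg, coe_one] at this
  rw [← this, neg_neg]

theorem circlePoint_add {u : ℍ[ℝ]} (hu : normSq u = 1) (hre : u.re = 0) (s t : ℝ) :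
    circlePoint u (s + t) = circlePoint u s * circlePoint u t := by
  have h : (circlePoint u s * circlePoint u t) = (Real.cos s * Real.cos t : ℝ) +
      (Real.sin s * Real.cos t + Real.cos s * Real.sin t) • u +
        (Real.sin s * Real.sin t) • (u * u) := by
    ext <;> simp <;> ring
  rw [h, mul_self_of_pure hu hre, circlePoint, Real.cos_add, Real.sin_add]
  ext <;> simp [hre]
  ring

theorem star_circlePoint {u : ℍ[ℝ]} (hre : u.re = 0) (t : ℝ) :
    star (circlePoint u t) = circlePoint u (-t) := by
  ext <;> simp [hre]

theorem normSq_circlePoint {u : ℍ[ℝ]} (hu : normSq u = 1) (hre : u.re = 0) (t : ℝ) :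
    normSq (circlePoint u t) = 1 := by
  rw [normSq_def'] at hu ⊢
  simp only [re_circlePoint, imI_circlePoint, imJ_circlePoint, imK_circlePoint, hre] at *
  linear_combination Real.sin t ^ 2 * hu + Real.sin_sq_add_cos_sq t

theorem circlePoint_pow {u : ℍ[ℝ]} (hu : normSq u = 1) (hre : u.re = 0) (t : ℝ) (n : ℕ) :
    circlePoint u t ^ n = circlePoint u (n * t) := by
  induction n with
  | zero => simp [circlePoint_zero]
  | succ n ih => rw [pow_succ, ih, ← circlePoint_add hu hre]; push_cast; ring_nf

theorem conj_circlePoint {g : ℍ[ℝ]} (hg : normSq g = 1) (u : ℍ[ℝ]) (t : ℝ) :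
    g * circlePoint u t * star g = circlePoint (g * u * star g) t := by
  rw [circlePoint, mul_add, add_mul, mul_coe_eq_smul, smul_mul_assoc, self_mul_star, hg,
    circlePoint, mul_smul_comm, smul_mul_assoc, smul_coe, mul_one]

theorem re_conj {g u : ℍ[ℝ]} (hre : u.re = 0) : (g * u * star g).re = 0 := by
  simp [hre]; ring

theorem normSq_conj {g : ℍ[ℝ]} (hg : normSq g = 1) (u : ℍ[ℝ]) :
    normSq (g * u * star g) = normSq u := by
  simp [hg]

/-- `K` contains the circle through `1` and `u`. -/
def ContainsCircle (K : Submonoid ℍ[ℝ]) (u : ℍ[ℝ]) : Prop := ∀ t, circlePoint u t ∈ K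

theorem ContainsCircle.neg {K : Submonoid ℍ[ℝ]} {u : ℍ[ℝ]} (h : ContainsCircle K u) :
    ContainsCircle K (-u) := fun t => by
  rw [circlePoint_neg_left]; exact h _

/-- The inverse of a point of the circle lies on the same circle, so the submonoid `K` may be
conjugated by it. -/
theorem ContainsCircle.conj {K : Submonoid ℍ[ℝ]} {u v : ℍ[ℝ]} (hu : normSq u = 1) (hre : u.re = 0)
    (h : ContainsCircle K u) (h' : ContainsCircle K v) (s : ℝ) :
    ContainsCircle K (circlePoint u s * v * star (circlePoint u s)) := fun t => by
  rw [← conj_circlePoint (normSq_circlePoint hu hre s)]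
  refine K.mul_mem (K.mul_mem (h _) (h' _)) ?_
  rw [star_circlePoint hre]
  exact h _

/-- Two orthogonal circles generate the unit quaternions. -/
theorem mem_of_orthogonal_circles {K : Submonoid ℍ[ℝ]} (hi : ContainsCircle K (quat 0 1 0 0))
    {v : ℍ[ℝ]} (hv : normSq v = 1) (hre : v.re = 0) (hvi : v.imI = 0) (h : ContainsCircle K v)
    {x : ℍ[ℝ]} (hx : normSq x = 1) : x ∈ K := by
  rw [normSq_def'] at hv hx
  -- Euler angles: write x = z + w j and v = ζ j with z, w, ζ complex. Then e^{it} (cos s + sin s v)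
  -- e^{ir} has components cos s e^{i(t+r)} and sin s ζ e^{i(t-r)}; the moduli of z, w fix s and the
  -- arguments fix t ± r.
  obtain ⟨z, hz⟩ : ∃ z : ℂ, z = ⟨x.re, x.imI⟩ := ⟨_, rfl⟩
  obtain ⟨w, hw⟩ : ∃ w : ℂ, w = ⟨x.imJ, x.imK⟩ := ⟨_, rfl⟩
  obtain ⟨ζ, hζ⟩ : ∃ ζ : ℂ, ζ = ⟨v.imJ, v.imK⟩ := ⟨_, rfl⟩
  have hζ1 : ‖ζ‖ = 1 := by
    rw [Complex.norm_def, Complex.normSq_apply, hζ, Real.sqrt_eq_one]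
    simp only
    rw [hre, hvi] at hv
    linarith
  have hzw : ‖z‖ ^ 2 + ‖w‖ ^ 2 = 1 := by
    rw [Complex.sq_norm, Complex.sq_norm, Complex.normSq_apply, Complex.normSq_apply, hz, hw]
    simp only
    linarith
  have hcos : Real.cos (Real.arccos ‖z‖) = ‖z‖ :=
    Real.cos_arccos (by linarith [norm_nonneg z]) (by nlinarith [norm_nonneg z, norm_nonneg w])
  have hsin : Real.sin (Real.arccos ‖z‖) = ‖w‖ := by
    rw [Real.sin_arccos, ← hzw, add_sub_cancel_left, Real.sqrt_sq (norm_nonneg _)]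
  set s := Real.arccos ‖z‖
  obtain ⟨t, ht⟩ : ∃ t, t = (z.arg + w.arg - ζ.arg) / 2 := ⟨_, rfl⟩
  obtain ⟨r, hr⟩ : ∃ r, r = (z.arg - w.arg + ζ.arg) / 2 := ⟨_, rfl⟩
  have e1 : z.arg = t + r := by rw [ht, hr]; ring
  have e2 : w.arg = t - r + ζ.arg := by rw [ht, hr]; ring
  have hzre := Complex.norm_mul_cos_arg z
  have hzim := Complex.norm_mul_sin_arg z
  have hwre := Complex.norm_mul_cos_arg w
  have hwim := Complex.norm_mul_sin_arg w
  have hζre := Complex.norm_mul_cos_arg ζ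
  have hζim := Complex.norm_mul_sin_arg ζ
  rw [e1, Real.cos_add, ← hcos] at hzre
  rw [e1, Real.sin_add, ← hcos] at hzim
  rw [hζ1, one_mul] at hζre hζim
  rw [e2, Real.cos_add, Real.cos_sub, Real.sin_sub, ← hsin, hζre, hζim] at hwre
  rw [e2, Real.sin_add, Real.cos_sub, Real.sin_sub, ← hsin, hζre, hζim] at hwim
  rw [hz] at hzre hzim
  rw [hw, hζ] at hwre hwim
  simp only at hzre hzim hwre hwim
  have hprod : x = circlePoint (quat 0 1 0 0) t * circlePoint v s *
      circlePoint (quat 0 1 0 0) r := by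
    ext <;> simp [hre, hvi]
    · linarith
    · linarith
    · linarith
    · linarith
  rw [hprod]
  exact K.mul_mem (K.mul_mem (hi _) (h _)) (hi _)

/-- With c = `v.imI`, conjugating i by the circle of v gives axes whose i-coordinate is c² + (1 -
c²) cos 2s. It vanishes for some s when c² ≤ 1/2. Otherwise a half turn about v doubles the angle to
i: the new coordinate 2c² - 1 is still nonnegative, and the gap 1 - c is at least doubled, so n
bounds the number of doublings. -/
theorem exists_orthogonal_circle {K : Submonoid ℍ[ℝ]} (hi : ContainsCircle K (quat 0 1 0 0))
    (n : ℕ) {v : ℍ[ℝ]} (hv : normSq v = 1) (hre : v.re = 0) (hvi : 0 ≤ v.imI)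
    (hn : 1 / 2 ^ n ≤ 1 - v.imI) (h : ContainsCircle K v) :
    ∃ w : ℍ[ℝ], normSq w = 1 ∧ w.re = 0 ∧ w.imI = 0 ∧ ContainsCircle K w := by
  induction n generalizing v with
  | zero => exact ⟨v, hv, hre, by norm_num at hn; linarith, h⟩
  | succ n ih =>
    have himI (s : ℝ) :
        (circlePoint v s * quat 0 1 0 0 * star (circlePoint v s)).imI =
          v.imI ^ 2 + (1 - v.imI ^ 2) * Real.cos (2 * s) := by
      rw [normSq_def', hre] at hv
      simp [hre, Real.cos_two_mul']
      linear_combination v.imI ^ 2 * (Real.sin_sq_add_cos_sq s) - Real.sin s ^ 2 * hv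
    have hconj (s : ℝ) := h.conj hv hre hi s
    have hnorm (s : ℝ) : normSq (circlePoint v s * quat 0 1 0 0 * star (circlePoint v s)) = 1 := by
      rw [normSq_conj (normSq_circlePoint hv hre s), normSq_quat]; norm_num
    have hpos : (0 : ℝ) < 1 / 2 ^ (n + 1) := by positivity
    have hlt : v.imI < 1 := by linarith
    by_cases hc : v.imI ^ 2 ≤ 1 / 2
    · have hd : 0 < 1 - v.imI ^ 2 := by linarith
      refine ⟨_, hnorm (Real.arccos (-(v.imI ^ 2 / (1 - v.imI ^ 2))) / 2), re_conj rfl, ?_,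
        hconj _⟩
      rw [himI, mul_div_cancel₀ _ (two_ne_zero' ℝ), Real.cos_arccos]
      · field_simp; ring
      · rw [neg_le_neg_iff, div_le_one hd]; linarith
      · have : 0 ≤ v.imI ^ 2 / (1 - v.imI ^ 2) := by positivity
        linarith
    · refine ih (hnorm (π / 2)) (re_conj rfl) ?_ ?_ (hconj _)
      · rw [himI, mul_div_cancel₀ _ (two_ne_zero' ℝ), Real.cos_pi]; linarith
      · rw [himI, mul_div_cancel₀ _ (two_ne_zero' ℝ), Real.cos_pi]
        rw [pow_succ, ← div_div, div_le_iff₀ two_pos] at hn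
        nlinarith

theorem mem_of_circle_i {K : Submonoid ℍ[ℝ]} (hi : ContainsCircle K (quat 0 1 0 0))
    {v : ℍ[ℝ]} (hv : normSq v = 1) (hre : v.re = 0) (hne : v ≠ quat 0 1 0 0)
    (hne' : v ≠ -quat 0 1 0 0) (h : ContainsCircle K v) {x : ℍ[ℝ]} (hx : normSq x = 1) :
    x ∈ K := by
  wlog hvi : 0 ≤ v.imI generalizing v
  -- The vectors v and -v define the same circle.
  · exact this (v := -v) (by simpa) (by simpa) (fun e => hne' (by rw [← e, neg_neg]))
      (fun e => hne (neg_injective e)) h.neg (by simp; linarith)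
  have hlt : v.imI < 1 := by
    rw [normSq_def', hre] at hv
    refine lt_of_le_of_ne (by nlinarith) fun h1 => hne ?_
    rw [h1] at hv
    ext
    · simpa using hre
    · simpa using h1
    · simp; nlinarith
    · simp; nlinarith
  obtain ⟨n, hn⟩ := exists_pow_lt_of_lt_one (sub_pos.2 hlt) (by norm_num : (1 / 2 : ℝ) < 1)
  rw [div_pow, one_pow] at hn
  obtain ⟨w, hw, hwre, hwi, hwK⟩ := exists_orthogonal_circle hi n hv hre hvi hn.le h
  exact mem_of_orthogonal_circles hi hw hwre hwi hwK hx

/-- Two different circles generate the unit quaternions. -/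
theorem mem_of_circles {K : Submonoid ℍ[ℝ]} {u v : ℍ[ℝ]} (hu : normSq u = 1) (hure : u.re = 0)
    (hv : normSq v = 1) (hvre : v.re = 0) (hne : v ≠ u) (hne' : v ≠ -u)
    (huK : ContainsCircle K u) (hvK : ContainsCircle K v) {x : ℍ[ℝ]} (hx : normSq x = 1) :
    x ∈ K := by
  obtain ⟨g, hg, hgu⟩ := exists_conj_eq_i hu hure
  have hgg : star g * g = 1 := by rw [star_mul_self, hg, coe_one]
  have hgg' : g * star g = 1 := by rw [self_mul_star, hg, coe_one]
  have hcancel (y : ℍ[ℝ]) : star g * (g * y * star g) * g = y := by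
    rw [mul_assoc g, ← mul_assoc, hgg, one_mul, mul_assoc, hgg, mul_one]
  -- The conjugate of `K` by g, which reduces to the case where one circle passes through i.
  let K' : Submonoid ℍ[ℝ] :=
    { carrier := {y | star g * y * g ∈ K}
      one_mem' := by simp [hgg]
      mul_mem' := fun {a b} ha hb => by
        have := K.mul_mem ha hb
        rwa [show star g * a * g * (star g * b * g) = star g * a * (g * star g) * b * g by
          simp only [mul_assoc], hgg', mul_one, mul_assoc (star g)] at this }
  have hcirc {y : ℍ[ℝ]} (hy : ContainsCircle K y) : ContainsCircle K' (g * y * star g) := by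
    intro t
    change star g * _ * g ∈ K
    rw [← conj_circlePoint hg, hcancel]
    exact hy t
  have key : g * x * star g ∈ K' := by
    refine mem_of_circle_i (hgu ▸ hcirc huK) (v := g * v * star g) (by rwa [normSq_conj hg])
      (re_conj hvre) ?_ ?_ (hcirc hvK) (by rwa [normSq_conj hg])
    · rw [← hgu]
      intro e
      exact hne (by rw [← hcancel v, e, hcancel])
    · rw [← hgu]
      intro e
      exact hne' (by rw [← hcancel v, e, mul_neg, neg_mul, hcancel])
  have := show star g * _ * g ∈ K from key
  rwa [hcancel] at this

/-- The parameters s whose point lies in `K` form a closed subgroup of ℝ containing t and the period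
2π; as their ratio is irrational, it is dense, hence everything. -/
theorem containsCircle_of_irrational {K : Submonoid ℍ[ℝ]} (hK : IsClosed (K : Set ℍ[ℝ]))
    (hstar : ∀ x ∈ K, star x ∈ K) {u : ℍ[ℝ]} (hu : normSq u = 1) (hre : u.re = 0) {t : ℝ}
    (ht : Irrational (t / (2 * π))) (h : circlePoint u t ∈ K) : ContainsCircle K u := by
  let S : AddSubgroup ℝ :=
    { carrier := {s | circlePoint u s ∈ K}
      zero_mem' := by simp [circlePoint_zero, K.one_mem]
      add_mem' := fun {a b} ha hb => by
        change circlePoint u (a + b) ∈ K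
        rw [circlePoint_add hu hre]; exact K.mul_mem ha hb
      neg_mem' := fun {a} ha => by
        change circlePoint u (-a) ∈ K
        rw [← star_circlePoint hre]; exact hstar _ ha }
  have hS : IsClosed (S : Set ℝ) := hK.preimage (continuous_circlePoint u)
  have hd : Dense (S : Set ℝ) := by
    refine (dense_addSubgroupClosure_pair_iff.2 ht).mono ?_
    rw [SetLike.coe_subset_coe, AddSubgroup.closure_le, Set.pair_subset_iff]
    refine ⟨h, ?_⟩
    change circlePoint u (2 * π) ∈ K
    rw [show circlePoint u (2 * π) = 1 by simp [circlePoint]]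
    exact K.one_mem
  intro s
  have : s ∈ (S : Set ℝ) := by
    rw [← hS.closure_eq, hd.closure_eq]; trivial
  exact this

/-- A closed group of unit quaternions that is normalized by `d` and contains a power of an element
`b` of infinite order is everything, unless `d` preserves the axis of `b`. -/
theorem mem_of_irrational_pow {K : Submonoid ℍ[ℝ]} (hK : IsClosed (K : Set ℍ[ℝ]))
    (hstar : ∀ x ∈ K, star x ∈ K) {u : ℍ[ℝ]} (hu : normSq u = 1) (hre : u.re = 0) {γ : ℝ}
    (hγ : Irrational (γ / π)) {N : ℕ} (hN : N ≠ 0) (hpow : circlePoint u γ ^ N ∈ K) {d : ℍ[ℝ]}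
    (hd : normSq d = 1) (hconj : ∀ x ∈ K, d * x * star d ∈ K) (hne : d * u * star d ≠ u)
    (hne' : d * u * star d ≠ -u) {x : ℍ[ℝ]} (hx : normSq x = 1) : x ∈ K := by
  rw [circlePoint_pow hu hre] at hpow
  have hc : ContainsCircle K u := by
    refine containsCircle_of_irrational hK hstar hu hre ?_ hpow
    have : (N * γ / (2 * π) : ℝ) = N * (γ / π) / (2 : ℕ) := by push_cast; ring
    rw [this]
    exact (hγ.natCast_mul hN).div_natCast two_ne_zero
  refine mem_of_circles hu hre (by rwa [normSq_conj hd]) (re_conj hre) hne hne' hc (fun t => ?_) hx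
  rw [← conj_circlePoint hd]
  exact hconj _ (hc t)

/-! ### Pure quaternions, conjugation and rotations of ℝ³ -/

/-- The pure quaternion with the given coordinates. -/
def pureQuat : (Fin 3 → ℝ) →ₗ[ℝ] ℍ[ℝ] where
  toFun x := quat 0 (x 0) (x 1) (x 2)
  map_add' x y := by ext <;> simp
  map_smul' c x := by ext <;> simp

@[simp] theorem re_pureQuat (x : Fin 3 → ℝ) : (pureQuat x).re = 0 := rfl

@[simp] theorem imI_pureQuat (x : Fin 3 → ℝ) : (pureQuat x).imI = x 0 := rfl

@[simp] theorem imJ_pureQuat (x : Fin 3 → ℝ) : (pureQuat x).imJ = x 1 := rfl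

@[simp] theorem imK_pureQuat (x : Fin 3 → ℝ) : (pureQuat x).imK = x 2 := rfl

theorem pureQuat_injective : Function.Injective pureQuat := fun x y h => by
  ext i
  fin_cases i
  · exact congrArg QuaternionAlgebra.imI h
  · exact congrArg QuaternionAlgebra.imJ h
  · exact congrArg QuaternionAlgebra.imK h

/-- The matrix of the conjugation by `a` on pure quaternions. -/
def adMatrix (a : ℍ[ℝ]) : Matrix (Fin 3) (Fin 3) ℝ :=
  !![a.re ^ 2 + a.imI ^ 2 - a.imJ ^ 2 - a.imK ^ 2, 2 * a.imI * a.imJ - 2 * a.re * a.imK,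
      2 * a.imI * a.imK + 2 * a.re * a.imJ;
    2 * a.imI * a.imJ + 2 * a.re * a.imK, a.re ^ 2 - a.imI ^ 2 + a.imJ ^ 2 - a.imK ^ 2,
      2 * a.imJ * a.imK - 2 * a.re * a.imI;
    2 * a.imI * a.imK - 2 * a.re * a.imJ, 2 * a.imJ * a.imK + 2 * a.re * a.imI,
      a.re ^ 2 - a.imI ^ 2 - a.imJ ^ 2 + a.imK ^ 2]

theorem conj_pureQuat (a : ℍ[ℝ]) (x : Fin 3 → ℝ) :
    a * pureQuat x * star a = pureQuat (adMatrix a *ᵥ x) := by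
  ext <;> simp [adMatrix, dotProduct, Fin.sum_univ_three] <;> ring

/-- For `a.re` = cos γ this is 1 + 2 cos 2γ, the trace of a rotation by 2γ. -/
theorem trace_adMatrix {a : ℍ[ℝ]} (ha : normSq a = 1) :
    (adMatrix a).trace = 4 * a.re ^ 2 - 1 := by
  rw [normSq_def'] at ha
  simp [adMatrix, Matrix.trace, Fin.sum_univ_three]
  linear_combination -ha

/-- The conjugation by `a` has the matrix `C` in the basis of pure quaternions given by the columns
of `W`. -/
def IsConjMatrix (W : Matrix (Fin 3) (Fin 3) ℝ) (a : ℍ[ℝ]) (C : Matrix (Fin 3) (Fin 3) ℝ) : Prop :=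
  ∀ x, a * pureQuat (W *ᵥ x) * star a = pureQuat (W *ᵥ (C *ᵥ x))

/-- The matrix `C` is similar to `adMatrix a` through `W`; the trace recovers the angle without `W`
having to be orthogonal. -/
theorem IsConjMatrix.trace {W : Matrix (Fin 3) (Fin 3) ℝ} (hW : W.det ≠ 0) {a : ℍ[ℝ]}
    (ha : normSq a = 1) {C : Matrix (Fin 3) (Fin 3) ℝ} (h : IsConjMatrix W a C) :
    C.trace = 4 * a.re ^ 2 - 1 := by
  have hmul : adMatrix a * W = W * C := by
    refine Matrix.ext_of_mulVec_single fun i => ?_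
    rw [← Matrix.mulVec_mulVec, ← Matrix.mulVec_mulVec]
    apply pureQuat_injective
    rw [← conj_pureQuat]
    exact h _
  have hunit : IsUnit W.det := hW.isUnit
  rw [← trace_adMatrix ha, ← Matrix.mul_nonsing_inv_cancel_right W (adMatrix a) hunit, hmul,
    Matrix.trace_mul_comm, Matrix.nonsing_inv_mul_cancel_left _ _ hunit]

theorem specialOrthogonal_transpose_mul {n : ℕ} (V : Matrix.specialOrthogonalGroup (Fin n) ℝ) :
    V.1ᵀ * V.1 = 1 :=
  (Matrix.mem_orthogonalGroup_iff' (Fin n) ℝ).1 (Matrix.mem_specialOrthogonalGroup_iff.1 V.2).1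

theorem specialOrthogonal_mul_transpose {n : ℕ} (V : Matrix.specialOrthogonalGroup (Fin n) ℝ) :
    V.1 * V.1ᵀ = 1 :=
  (Matrix.mem_orthogonalGroup_iff (Fin n) ℝ).1 (Matrix.mem_specialOrthogonalGroup_iff.1 V.2).1

section Rotation

variable {C : Matrix.specialOrthogonalGroup (Fin 3) ℝ} {θ : ℝ} {p : EuclideanSpace ℝ (Fin 3)}

theorem IsRotation.trace (h : IsRotation C θ p) : C.1.trace = 1 + 2 * Real.cos θ := by
  obtain ⟨V, hV, -⟩ := h
  rw [hV, Matrix.trace_mul_comm, ← mul_assoc, specialOrthogonal_transpose_mul, one_mul]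
  simp [rotMatrix, Matrix.trace, Fin.sum_univ_three]
  ring

theorem IsRotation.mulVec_axis (h : IsRotation C θ p) : C.1 *ᵥ p = p := by
  obtain ⟨V, hV, hp⟩ := h
  have hp' : (p : Fin 3 → ℝ) = V.1 *ᵥ ![1, 0, 0] := by
    ext i
    simp [hp, Matrix.mulVec, dotProduct, Fin.sum_univ_three]
  rw [hV, hp', Matrix.mulVec_mulVec, mul_assoc, specialOrthogonal_transpose_mul, mul_one,
    ← Matrix.mulVec_mulVec]
  congr 1
  ext i
  fin_cases i <;> simp [rotMatrix]

theorem IsRotation.axis_ne_zero (h : IsRotation C θ p) : (p : Fin 3 → ℝ) ≠ 0 := by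
  obtain ⟨V, hV, hp⟩ := h
  intro h0
  have h1 := congrFun (congrFun (specialOrthogonal_transpose_mul V) 0) 0
  simp only [Matrix.mul_apply, Matrix.transpose_apply, ← hp, h0] at h1
  simp at h1

/-- A quaternion that acts as a rotation lies on a circle with the same axis, at half the angle. -/
theorem exists_circlePoint_of_isRotation (hrot : IsRotation C θ p)
    {W : Matrix (Fin 3) (Fin 3) ℝ} (hW : W.det ≠ 0) {a : ℍ[ℝ]} (ha : normSq a = 1)
    (h : IsConjMatrix W a C.1) :
    ∃ (r γ : ℝ) (k : ℤ), r ≠ 0 ∧ normSq (pureQuat (W *ᵥ (r • (p : Fin 3 → ℝ)))) = 1 ∧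
      a = circlePoint (pureQuat (W *ᵥ (r • (p : Fin 3 → ℝ)))) γ ∧
      (θ = 2 * k * π + 2 * γ ∨ θ = 2 * k * π - 2 * γ) := by
  have hx : W *ᵥ (p : Fin 3 → ℝ) ≠ 0 := fun h0 =>
    hW (Matrix.exists_mulVec_eq_zero_iff.1 ⟨_, hrot.axis_ne_zero, h0⟩)
  have hq : 0 < normSq (pureQuat (W *ᵥ (p : Fin 3 → ℝ))) :=
    lt_of_le_of_ne normSq_nonneg fun h0 => hx <| pureQuat_injective <| by
      rw [normSq_eq_zero.1 h0.symm, map_zero]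
  -- As `W` need not be an isometry, the image of the axis is rescaled to length 1.
  obtain ⟨r, hr⟩ : ∃ r : ℝ, r ^ 2 * normSq (pureQuat (W *ᵥ (p : Fin 3 → ℝ))) = 1 := by
    refine ⟨(√(normSq (pureQuat (W *ᵥ (p : Fin 3 → ℝ)))))⁻¹, ?_⟩
    rw [inv_pow, Real.sq_sqrt hq.le, inv_mul_cancel₀ hq.ne']
  have hr0 : r ≠ 0 := by rintro rfl; simp at hr
  have hu : normSq (pureQuat (W *ᵥ (r • (p : Fin 3 → ℝ)))) = 1 := by
    rw [Matrix.mulVec_smul, map_smul, normSq_smul, hr]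
  have hcomm : a * pureQuat (W *ᵥ (r • (p : Fin 3 → ℝ))) =
      pureQuat (W *ᵥ (r • (p : Fin 3 → ℝ))) * a := by
    have h1 := h (r • (p : Fin 3 → ℝ))
    rw [Matrix.mulVec_smul C.1, hrot.mulVec_axis] at h1
    conv_rhs => rw [← h1, mul_assoc, star_mul_self, ha, coe_one, mul_one]
  have htr := h.trace hW ha
  rw [hrot.trace] at htr
  set u := pureQuat (W *ᵥ (r • (p : Fin 3 → ℝ))) with hudef
  have hure : u.re = 0 := rfl
  have c1 := congrArg QuaternionAlgebra.imI hcomm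
  have c2 := congrArg QuaternionAlgebra.imJ hcomm
  have c3 := congrArg QuaternionAlgebra.imK hcomm
  simp only [imI_mul, imJ_mul, imK_mul, hure] at c1 c2 c3
  have hu' := hu
  rw [normSq_def', hure] at hu'
  have ha' := ha
  rw [normSq_def'] at ha'
  obtain ⟨β, hβ⟩ : ∃ β, β = a.imI * u.imI + a.imJ * u.imJ + a.imK * u.imK := ⟨_, rfl⟩
  -- Commuting with u means that the imaginary part of a has zero cross product with u, so it is its
  -- orthogonal projection β u.
  have e1 : a.imI = β * u.imI := by
    rw [hβ]; linear_combination (-a.imI) * hu' + u.imJ * c3 / 2 - u.imK * c2 / 2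
  have e2 : a.imJ = β * u.imJ := by
    rw [hβ]; linear_combination (-a.imJ) * hu' + u.imK * c1 / 2 - u.imI * c3 / 2
  have e3 : a.imK = β * u.imK := by
    rw [hβ]; linear_combination (-a.imK) * hu' + u.imI * c2 / 2 - u.imJ * c1 / 2
  have hsum : a.re ^ 2 + β ^ 2 = 1 := by
    rw [e1, e2, e3] at ha'
    linear_combination ha' - β ^ 2 * hu'
  obtain ⟨γ, hcos, hsin⟩ := exists_cos_sin hsum
  -- The trace yields only the cosine, hence the undetermined sign in the conclusion.
  have hθ : Real.cos (2 * γ) = Real.cos θ := by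
    rw [Real.cos_two_mul, hcos]; linarith
  obtain ⟨k, hk⟩ := Real.cos_eq_cos_iff.1 hθ
  refine ⟨r, γ, k, hr0, hu, ?_, hk⟩
  ext
  · simp [hcos]
  · rw [imI_circlePoint, hsin, e1]
  · rw [imJ_circlePoint, hsin, e2]
  · rw [imK_circlePoint, hsin, e3]

theorem exists_pow_eq_one_of_isRotation {q : ℚ} (hrot : IsRotation C (q * π) p)
    {W : Matrix (Fin 3) (Fin 3) ℝ} (hW : W.det ≠ 0) {a : ℍ[ℝ]} (ha : normSq a = 1)
    (h : IsConjMatrix W a C.1) : ∃ N : ℕ, N ≠ 0 ∧ a ^ N = 1 := by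
  obtain ⟨r, γ, k, -, hu, hau, hk⟩ := exists_circlePoint_of_isRotation hrot hW ha h
  -- Modulo π, γ is ±qπ/2: one factor 2 clears this half and another turns multiples of π into
  -- multiples of 2π.
  refine ⟨4 * q.den, by simp [q.den_nz], ?_⟩
  have hq : (q : ℝ) * q.den = q.num := by exact_mod_cast Rat.mul_den_eq_num q
  have hm : ∃ m : ℤ, (4 * q.den : ℕ) * γ = m * (2 * π) := by
    rcases hk with hk | hk
    · refine ⟨q.num - 2 * k * q.den, ?_⟩
      push_cast
      rw [← hq]
      linear_combination (-2 * q.den) * hk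
    · refine ⟨2 * k * q.den - q.num, ?_⟩
      push_cast
      rw [← hq]
      linear_combination (2 * q.den) * hk
  obtain ⟨m, hm⟩ := hm
  rw [hau, circlePoint_pow hu rfl, hm, circlePoint]
  have hsin : Real.sin (m * (2 * π)) = 0 := by simpa using Real.sin_add_int_mul_two_pi 0 m
  rw [Real.cos_int_mul_two_pi, hsin, coe_one, zero_smul, add_zero]

/-- A rotation by an angle which is not a multiple of `π` moves the line spanned by a vector that
is not on its axis. -/
theorem IsRotation.mulVec_ne {q : ℚ} (hq : ∀ n : ℤ, q ≠ n) (hrot : IsRotation C (q * π) p)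
    {p' : EuclideanSpace ℝ (Fin 3)} (hp' : (p' : Fin 3 → ℝ) ≠ 0)
    (hangle : InnerProductGeometry.angle p' p ∈ Set.Ioc 0 (π / 2)) :
    C.1 *ᵥ p' ≠ p' ∧ C.1 *ᵥ p' ≠ -(p' : Fin 3 → ℝ) := by
  have hsin : Real.sin (q * π) ≠ 0 := by
    intro h0
    obtain ⟨n, hn⟩ := Real.sin_eq_zero_iff.1 h0
    exact hq n (by exact_mod_cast (mul_right_cancel₀ Real.pi_ne_zero hn).symm)
  obtain ⟨V, hV, hp⟩ := hrot
  obtain ⟨x, hx⟩ : ∃ x : Fin 3 → ℝ, x = V.1ᵀ *ᵥ p' := ⟨_, rfl⟩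
  have hVx : (p' : Fin 3 → ℝ) = V.1 *ᵥ x := by
    rw [hx, Matrix.mulVec_mulVec, specialOrthogonal_mul_transpose, Matrix.one_mulVec]
  have hCx : V.1ᵀ *ᵥ (C.1 *ᵥ p') = rotMatrix (q * π) *ᵥ x := by
    rw [hV, hVx, Matrix.mulVec_mulVec, Matrix.mulVec_mulVec, mul_assoc V.1, ← mul_assoc,
      specialOrthogonal_transpose_mul, one_mul, mul_assoc, specialOrthogonal_transpose_mul, mul_one]
  have hcs := Real.sin_sq_add_cos_sq (q * π)
  have hs2 : 0 < Real.sin (q * π) ^ 2 := by positivity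
  constructor
  · intro h
    rw [h, ← hx] at hCx
    have h1 := congrFun hCx 1
    have h2 := congrFun hCx 2
    simp [rotMatrix, Matrix.mulVec, dotProduct, Fin.sum_univ_three] at h1 h2
    -- The components off the axis solve a system of determinant 2 (1 - cos); multiplied by (1 +
    -- cos) / 2 this is sin². They vanish, so p' is parallel to p, at angle 0 or π.
    have hx1 : Real.sin (q * π) ^ 2 * x 1 = 0 := by
      linear_combination (1 + Real.cos (q * π)) / 2 * ((1 - Real.cos (q * π)) * h1 -
        Real.sin (q * π) * h2) + x 1 * (1 - Real.cos (q * π)) / 2 * hcs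
    have hx2 : Real.sin (q * π) ^ 2 * x 2 = 0 := by
      linear_combination (1 + Real.cos (q * π)) / 2 * ((1 - Real.cos (q * π)) * h2 +
        Real.sin (q * π) * h1) + x 2 * (1 - Real.cos (q * π)) / 2 * hcs
    replace hx1 := (mul_eq_zero.1 hx1).resolve_left hs2.ne'
    replace hx2 := (mul_eq_zero.1 hx2).resolve_left hs2.ne'
    have hpp : p' = x 0 • p := by
      ext i
      rw [hVx]
      simp [Matrix.mulVec, dotProduct, Fin.sum_univ_three, hx1, hx2, hp, mul_comm]
    have hp0 : p ≠ 0 := by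
      rintro rfl
      exact hp' (by rw [hpp, smul_zero]; rfl)
    rcases lt_trichotomy (x 0) 0 with h0 | h0 | h0
    · rw [hpp, InnerProductGeometry.angle_smul_left_of_neg _ _ h0,
        InnerProductGeometry.angle_neg_self_of_nonzero hp0] at hangle
      linarith [hangle.2, Real.pi_pos]
    · exact hp' (by rw [hpp, h0, zero_smul]; rfl)
    · rw [hpp, InnerProductGeometry.angle_smul_left_of_pos _ _ h0,
        InnerProductGeometry.angle_self hp0] at hangle
      exact lt_irrefl _ hangle.1
  · intro h
    rw [h, Matrix.mulVec_neg, ← hx] at hCx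
    have h0 := congrFun hCx 0
    have h1 := congrFun hCx 1
    have h2 := congrFun hCx 2
    simp [rotMatrix, Matrix.mulVec, dotProduct, Fin.sum_univ_three] at h0 h1 h2
    -- Since sin ≠ 0, -1 is not an eigenvalue, so x = 0.
    have hx1 : Real.sin (q * π) ^ 2 * x 1 = 0 := by
      linear_combination -(1 - Real.cos (q * π)) / 2 * ((1 + Real.cos (q * π)) * h1 +
        Real.sin (q * π) * h2) + x 1 * (1 + Real.cos (q * π)) / 2 * hcs
    have hx2 : Real.sin (q * π) ^ 2 * x 2 = 0 := by
      linear_combination -(1 - Real.cos (q * π)) / 2 * ((1 + Real.cos (q * π)) * h2 -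
        Real.sin (q * π) * h1) + x 2 * (1 + Real.cos (q * π)) / 2 * hcs
    replace hx1 := (mul_eq_zero.1 hx1).resolve_left hs2.ne'
    replace hx2 := (mul_eq_zero.1 hx2).resolve_left hs2.ne'
    refine hp' ?_
    rw [hVx]
    convert Matrix.mulVec_zero V.1
    ext i
    fin_cases i
    · simp; linarith
    · exact hx1
    · exact hx2

end Rotation

/-- A closed group of unit quaternions contains all unit quaternions if it contains a power of a
quaternion `b` that acts as a rotation of infinite order and is normalized by a quaternion that acts
as a rotation of finite order which moves the axis of `b`. -/
theorem mem_of_isRotation {K : Submonoid ℍ[ℝ]} (hK : IsClosed (K : Set ℍ[ℝ]))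
    (hstar : ∀ x ∈ K, star x ∈ K) {W : Matrix (Fin 3) (Fin 3) ℝ} (hW : W.det ≠ 0)
    {C D : Matrix.specialOrthogonalGroup (Fin 3) ℝ} {ψ : ℝ} (hψ : Irrational ψ) {q : ℚ}
    (hq : ∀ n : ℤ, q ≠ n) {p p' : EuclideanSpace ℝ (Fin 3)} (hC : IsRotation C (ψ * π) p)
    (hD : IsRotation D (q * π) p')
    (hangle : InnerProductGeometry.angle p p' ∈ Set.Ioc 0 (π / 2)) {b d : ℍ[ℝ]}
    (hb : normSq b = 1) (hd : normSq d = 1) (hbC : IsConjMatrix W b C.1)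
    (hdD : IsConjMatrix W d D.1) {N : ℕ} (hN : N ≠ 0) (hbN : b ^ N ∈ K)
    (hconj : ∀ x ∈ K, d * x * star d ∈ K) {x : ℍ[ℝ]} (hx : normSq x = 1) : x ∈ K := by
  obtain ⟨r, γ, k, hr, hu, hbu, hk⟩ := exists_circlePoint_of_isRotation hC hW hb hbC
  have hinj : Function.Injective fun y => pureQuat (W *ᵥ y) :=
    pureQuat_injective.comp (Matrix.mulVec_injective_of_isUnit
      ((Matrix.isUnit_iff_isUnit_det _).2 hW.isUnit))
  obtain ⟨hne, hne'⟩ := hD.mulVec_ne hq hC.axis_ne_zero hangle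
  have hγ : Irrational (γ / π) := by
    rcases hk with hk | hk
    · have : γ / π = (ψ - (2 * k : ℤ)) / (2 : ℕ) := by
        field_simp
        push_cast
        linear_combination -hk
      rw [this]
      exact (hψ.sub_intCast _).div_natCast two_ne_zero
    · have : γ / π = ((2 * k : ℤ) - ψ) / (2 : ℕ) := by
        field_simp
        push_cast
        linear_combination hk
      rw [this]
      exact (hψ.intCast_sub _).div_natCast two_ne_zero
  refine mem_of_irrational_pow hK hstar hu rfl hγ hN (hbu ▸ hbN) hd hconj ?_ ?_ hx
  · rw [hdD, Matrix.mulVec_smul]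
    intro e
    exact hne (smul_right_injective _ hr (hinj e))
  · rw [hdD, Matrix.mulVec_smul, ← map_neg, ← Matrix.mulVec_neg, ← smul_neg]
    intro e
    exact hne' (smul_right_injective _ hr (hinj e))

/-! ### Closed groups of 4 × 4 matrices -/

/-- The unit quaternions whose left multiplications are in `H`. -/
def leftSubmonoid (H : Submonoid (Matrix (Fin 4) (Fin 4) ℝ)) : Submonoid ℍ[ℝ] where
  carrier := {x | normSq x = 1 ∧ leftMatrix x ∈ H}
  one_mem' := ⟨map_one _, by rw [leftMatrix_one]; exact H.one_mem⟩
  mul_mem' hx hy := ⟨by rw [map_mul, hx.1, hy.1, one_mul],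
    by rw [leftMatrix_mul]; exact H.mul_mem hx.2 hy.2⟩

/-- The unit quaternions whose right multiplications are in `H`. -/
def rightSubmonoid (H : Submonoid (Matrix (Fin 4) (Fin 4) ℝ)) : Submonoid ℍ[ℝ] where
  carrier := {x | normSq x = 1 ∧ rightMatrix x ∈ H}
  one_mem' := ⟨map_one _, by rw [rightMatrix_one]; exact H.one_mem⟩
  mul_mem' hx hy := ⟨by rw [map_mul, hx.1, hy.1, one_mul],
    by rw [rightMatrix_mul]; exact H.mul_mem hx.2 hy.2⟩

theorem continuous_leftMatrix : Continuous leftMatrix := by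
  refine continuous_matrix fun i j => ?_
  fin_cases i <;> fin_cases j <;> simp only [leftMatrix] <;>
    first
    | exact continuous_re
    | exact continuous_imI
    | exact continuous_imJ
    | exact continuous_imK
    | exact continuous_imI.neg
    | exact continuous_imJ.neg
    | exact continuous_imK.neg

theorem continuous_rightMatrix : Continuous rightMatrix := by
  refine continuous_matrix fun i j => ?_
  fin_cases i <;> fin_cases j <;> simp only [rightMatrix] <;>
    first
    | exact continuous_re
    | exact continuous_imI
    | exact continuous_imJ
    | exact continuous_imK
    | exact continuous_imI.neg
    | exact continuous_imJ.neg
    | exact continuous_imK.neg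

section

variable {H : Submonoid (Matrix (Fin 4) (Fin 4) ℝ)}

theorem isClosed_leftSubmonoid (hH : IsClosed (H : Set (Matrix (Fin 4) (Fin 4) ℝ))) :
    IsClosed (leftSubmonoid H : Set ℍ[ℝ]) :=
  (isClosed_eq continuous_normSq continuous_const).inter (hH.preimage continuous_leftMatrix)

theorem isClosed_rightSubmonoid (hH : IsClosed (H : Set (Matrix (Fin 4) (Fin 4) ℝ))) :
    IsClosed (rightSubmonoid H : Set ℍ[ℝ]) :=
  (isClosed_eq continuous_normSq continuous_const).inter (hH.preimage continuous_rightMatrix)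

theorem sandwich_transpose (a b : ℍ[ℝ]) :
    (leftMatrix a * rightMatrix b)ᵀ = leftMatrix (star a) * rightMatrix (star b) := by
  rw [Matrix.transpose_mul, ← leftMatrix_star, ← rightMatrix_star, leftMatrix_mul_rightMatrix_comm]

/-- The right factor commutes with `leftMatrix x` and cancels against its own transpose. -/
theorem sandwich_conj_leftMatrix {a b : ℍ[ℝ]} (hb : normSq b = 1) (x : ℍ[ℝ]) :
    leftMatrix a * rightMatrix b * leftMatrix x * (leftMatrix a * rightMatrix b)ᵀ =
      leftMatrix (a * x * star a) := by
  have := sandwich_mul a b x 1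
  rw [rightMatrix_one, mul_one, mul_one] at this
  rw [this, sandwich_transpose, sandwich_mul, self_mul_star, hb, coe_one, rightMatrix_one, mul_one]

theorem sandwich_conj_rightMatrix {a b : ℍ[ℝ]} (ha : normSq a = 1) (x : ℍ[ℝ]) :
    leftMatrix a * rightMatrix b * rightMatrix x * (leftMatrix a * rightMatrix b)ᵀ =
      rightMatrix (b * x * star b) := by
  have := sandwich_mul a b 1 x
  rw [leftMatrix_one, one_mul, mul_one] at this
  rw [this, sandwich_transpose, sandwich_mul, self_mul_star, ha, coe_one, leftMatrix_one, one_mul]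

theorem sandwich_pow (a b : ℍ[ℝ]) (n : ℕ) :
    (leftMatrix a * rightMatrix b) ^ n = leftMatrix (a ^ n) * rightMatrix (b ^ n) := by
  rw [leftMatrix_pow, rightMatrix_pow,
    (show Commute (leftMatrix a) (rightMatrix b) from leftMatrix_mul_rightMatrix_comm a b).mul_pow]

end

/-- A closed group of `4 × 4` matrices that contains `x ↦ a₁ * x * star b₁` and
`x ↦ a₂ * x * star b₂` contains all rotations, if `a₁`, `b₂` act as rotations of finite order on the
pure quaternions, `a₂`, `b₁` as rotations of infinite order, and the axes are suitably placed. -/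
theorem mem_of_isRotation_pairs {H : Submonoid (Matrix (Fin 4) (Fin 4) ℝ)}
    (hH : IsClosed (H : Set (Matrix (Fin 4) (Fin 4) ℝ))) (htr : ∀ A ∈ H, Aᵀ ∈ H)
    {a₁ b₁ a₂ b₂ : ℍ[ℝ]} (ha₁ : normSq a₁ = 1) (hb₁ : normSq b₁ = 1) (ha₂ : normSq a₂ = 1)
    (hb₂ : normSq b₂ = 1) (h₁ : leftMatrix a₁ * rightMatrix b₁ ∈ H)
    (h₂ : leftMatrix a₂ * rightMatrix b₂ ∈ H)
    {W W' : Matrix (Fin 3) (Fin 3) ℝ} (hW : W.det ≠ 0) (hW' : W'.det ≠ 0)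
    {C₁ C₂ D₁ D₂ : Matrix.specialOrthogonalGroup (Fin 3) ℝ} (hC₁ : IsConjMatrix W a₁ C₁.1)
    (hC₂ : IsConjMatrix W a₂ C₂.1) (hD₁ : IsConjMatrix W' b₁ D₁.1) (hD₂ : IsConjMatrix W' b₂ D₂.1)
    {q₁ q₂ : ℚ} {ψ₁ ψ₂ : ℝ} (hq₁ : ∀ n : ℤ, q₁ ≠ n) (hq₂ : ∀ n : ℤ, q₂ ≠ n)
    (hψ₁ : Irrational ψ₁) (hψ₂ : Irrational ψ₂) {p₁ p₂ p₁' p₂' : EuclideanSpace ℝ (Fin 3)}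
    (rC₁ : IsRotation C₁ (q₁ * π) p₁) (rC₂ : IsRotation C₂ (ψ₂ * π) p₂)
    (rD₁ : IsRotation D₁ (ψ₁ * π) p₁') (rD₂ : IsRotation D₂ (q₂ * π) p₂')
    (hangle : InnerProductGeometry.angle p₁ p₂ ∈ Set.Ioc 0 (π / 2))
    (hangle' : InnerProductGeometry.angle p₁' p₂' ∈ Set.Ioc 0 (π / 2))
    {A : Matrix (Fin 4) (Fin 4) ℝ} (hA : Aᵀ * A = 1) (hdet : A.det = 1) : A ∈ H := by
  obtain ⟨N, hN, haN⟩ := exists_pow_eq_one_of_isRotation rC₁ hW ha₁ hC₁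
  obtain ⟨M, hM, hbM⟩ := exists_pow_eq_one_of_isRotation rD₂ hW' hb₂ hD₂
  obtain ⟨a, b, ha, hb, rfl⟩ := isSandwich_of_det_eq_one hA hdet
  refine H.mul_mem ?_ ?_
  · suffices a ∈ leftSubmonoid H from this.2
    rw [InnerProductGeometry.angle_comm] at hangle
    refine mem_of_isRotation (isClosed_leftSubmonoid hH)
      (fun x hx => ⟨by simpa using hx.1, by rw [leftMatrix_star]; exact htr _ hx.2⟩) hW hψ₂ hq₁ rC₂
      rC₁ hangle ha₂ ha₁ hC₂ hC₁ hM ⟨by simp [ha₂], ?_⟩ (fun x hx => ⟨?_, ?_⟩) ha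
    -- The exponent M kills the right factor b₂, leaving a pure left multiplication.
    · have := H.pow_mem h₂ M
      rwa [sandwich_pow, hbM, rightMatrix_one, mul_one] at this
    · rw [normSq_conj ha₁, hx.1]
    · rw [← sandwich_conj_leftMatrix hb₁]
      exact H.mul_mem (H.mul_mem h₁ hx.2) (htr _ h₁)
  · suffices b ∈ rightSubmonoid H from this.2
    refine mem_of_isRotation (isClosed_rightSubmonoid hH)
      (fun x hx => ⟨by simpa using hx.1, by rw [rightMatrix_star]; exact htr _ hx.2⟩) hW' hψ₁ hq₂ rD₁
      rD₂ hangle' hb₁ hb₂ hD₁ hD₂ hN ⟨by simp [hb₁], ?_⟩ (fun x hx => ⟨?_, ?_⟩) hb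
    · have := H.pow_mem h₁ N
      rwa [sandwich_pow, haN, leftMatrix_one, one_mul] at this
    · rw [normSq_conj hb₂, hx.1]
    · rw [← sandwich_conj_rightMatrix ha₂]
      exact H.mul_mem (H.mul_mem h₂ hx.2) (htr _ h₂)

/-! ### Product rules and constancy along parallel sections -/

section Wedge

variable {V : Type*} [NormedAddCommGroup V] [InnerProductSpace ℝ V] [FiniteDimensional ℝ V]

theorem inner_wedge (a b c d : V) :
    inner ℝ (wedge a b) (wedge c d) =
      inner ℝ a c * inner ℝ b d - inner ℝ a d * inner ℝ b c := by
  rw [wedge, wedge, exteriorPower.inner_ιMulti_ιMulti, Matrix.det_fin_two]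
  simp
  ring

end Wedge

section Bundle

variable {E : Torus → Type*} [TopologicalSpace (Bundle.TotalSpace R4 E)]
  [∀ b, NormedAddCommGroup (E b)] [∀ b, InnerProductSpace ℝ (E b)]
  [FiberBundle R4 E] [VectorBundle ℝ R4 E] [ContMDiffVectorBundle ∞ R4 E IT]
  [IsContMDiffRiemannianBundle IT ∞ R4 E]

theorem hasDerivAt_inner_section {nabla : CovariantDerivative IT R4 E}
    (hmetric : nabla.IsMetricCompatible) {c : ℝ → Torus} {t : ℝ}
    (hc : MDifferentiableAt 𝓘(ℝ, ℝ) IT c t) {s r : ∀ b, E b}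
    (hs : ContMDiffAt IT (IT.prod 𝓘(ℝ, R4)) ∞ (fun b => Bundle.TotalSpace.mk' R4 b (s b)) (c t))
    (hr : ContMDiffAt IT (IT.prod 𝓘(ℝ, R4)) ∞ (fun b => Bundle.TotalSpace.mk' R4 b (r b)) (c t)) :
    HasDerivAt (fun τ => inner ℝ (s (c τ)) (r (c τ)))
      (inner ℝ (nabla s (c t) (velocity c t)) (r (c t)) +
        inner ℝ (s (c t)) (nabla r (c t) (velocity c t))) t := by
  have hs' := hs.mdifferentiableAt (by simp)
  have hr' := hr.mdifferentiableAt (by simp)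
  have hinner := MDifferentiableAt.inner_bundle (b := id) hs' hr'
  -- Metric compatibility is stated for a vector field; only its value at `c t` matters.
  let X : ∀ x : Torus, TangentSpace IT x := fun _ => velocity c t
  have hX := hmetric.mvfderiv_inner_eq X hs' hr'
  have hcomp := mvfderiv_comp_apply t hinner hc (1 : ℝ)
  have hd : DifferentiableAt ℝ (fun τ => inner ℝ (s (c τ)) (r (c τ))) t :=
    (hinner.comp t hc).differentiableAt
  have hval : deriv (fun τ => inner ℝ (s (c τ)) (r (c τ))) t =
      inner ℝ (nabla s (c t) (velocity c t)) (r (c t)) +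
        inner ℝ (s (c t)) (nabla r (c t) (velocity c t)) := by
    rw [← fderiv_apply_one_eq_deriv]
    refine Eq.trans ?_ (hcomp.trans hX)
    simp only [mvfderiv, mfderiv_eq_fderiv]
    rfl
  rw [← hval]
  exact hd.hasDerivAt

/-- Both decompositions are expanded bilinearly. Any decompositions serve, so independence of the
covariant derivative from the choice is not needed. -/
theorem HasCovDerivAlongAt.hasDerivAt_inner {nabla : CovariantDerivative IT R4 E}
    (hmetric : nabla.IsMetricCompatible) {c : ℝ → Torus} {t : ℝ}
    (hc : MDifferentiableAt 𝓘(ℝ, ℝ) IT c t) {ξ η : ∀ t, E (c t)} {v w : E (c t)}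
    (hξ : HasCovDerivAlongAt nabla c ξ t v) (hη : HasCovDerivAlongAt nabla c η t w) :
    HasDerivAt (fun τ => inner ℝ (ξ τ) (η τ)) (inner ℝ v (η t) + inner ℝ (ξ t) w) t := by
  obtain ⟨n, f, s, hf, hs, hξs, rfl⟩ := hξ
  obtain ⟨m, g, r, hg, hr, hηr, rfl⟩ := hη
  have hsum : HasDerivAt (fun τ => ∑ i, ∑ j, f i τ * g j τ * inner ℝ (s i (c τ)) (r j (c τ)))
      (∑ i, ∑ j, ((deriv (f i) t * g j t + f i t * deriv (g j) t) * inner ℝ (s i (c t)) (r j (c t)) +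
        f i t * g j t * (inner ℝ (nabla (s i) (c t) (velocity c t)) (r j (c t)) +
        inner ℝ (s i (c t)) (nabla (r j) (c t) (velocity c t))))) t :=
    HasDerivAt.fun_sum fun i _ => HasDerivAt.fun_sum fun j _ =>
      ((hf i).hasDerivAt.mul (hg j).hasDerivAt).mul
        (hasDerivAt_inner_section hmetric hc (hs i) (hr j))
  refine (hsum.congr_of_eventuallyEq ?_).congr_deriv ?_
  · filter_upwards [hξs, hηr] with τ h1 h2
    rw [h1, h2, sum_inner]
    simp only [inner_sum, real_inner_smul_left, real_inner_smul_right]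
    exact Finset.sum_congr rfl fun i _ => Finset.sum_congr rfl fun j _ => by ring
  · rw [hξs.self_of_nhds, hηr.self_of_nhds, sum_inner, sum_inner, ← Finset.sum_add_distrib]
    refine Finset.sum_congr rfl fun i _ => ?_
    rw [inner_sum, inner_sum, ← Finset.sum_add_distrib]
    refine Finset.sum_congr rfl fun j _ => ?_
    simp only [inner_add_left, inner_add_right, real_inner_smul_left, real_inner_smul_right]
    ring

variable [∀ b, FiniteDimensional ℝ (E b)]

theorem HasCovDerivAlongAt₂.hasDerivAt_inner_wedge {nabla : CovariantDerivative IT R4 E}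
    (hmetric : nabla.IsMetricCompatible) {c : ℝ → Torus} {t : ℝ}
    (hc : MDifferentiableAt 𝓘(ℝ, ℝ) IT c t) {Ω : ∀ t, ⋀[ℝ]^2 (E (c t))} {σ : ⋀[ℝ]^2 (E (c t))}
    (hΩ : HasCovDerivAlongAt₂ nabla c Ω t σ) {ξ η : ∀ t, E (c t)}
    (hξ : HasCovDerivAlongAt nabla c ξ t 0) (hη : HasCovDerivAlongAt nabla c η t 0) :
    HasDerivAt (fun τ => inner ℝ (Ω τ) (wedge (ξ τ) (η τ)))
      (inner ℝ σ (wedge (ξ t) (η t))) t := by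
  obtain ⟨n, a, b, a', b', ha, hb, hab, rfl⟩ := hΩ
  have hsum := HasDerivAt.fun_sum (u := Finset.univ) fun k _ =>
    (((ha k).hasDerivAt_inner hmetric hc hξ).mul ((hb k).hasDerivAt_inner hmetric hc hη)).sub
    (((ha k).hasDerivAt_inner hmetric hc hη).mul ((hb k).hasDerivAt_inner hmetric hc hξ))
  refine (hsum.congr_of_eventuallyEq ?_).congr_deriv ?_
  · filter_upwards [hab] with τ h
    rw [h, sum_inner]
    exact Finset.sum_congr rfl fun k _ => inner_wedge _ _ _ _
  · rw [sum_inner]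
    refine Finset.sum_congr rfl fun k _ => ?_
    rw [inner_add_left, inner_wedge, inner_wedge]
    simp only [inner_zero_right, add_zero]
    ring

/-- The inner products of a horizontal section of `⋀² E` with the bivectors of parallel sections
are constant. -/
theorem inner_wedge_eq_of_parallel {nabla : CovariantDerivative IT R4 E}
    (hmetric : nabla.IsMetricCompatible) {c : ℝ → Torus} (hc : MDifferentiable 𝓘(ℝ, ℝ) IT c)
    {Ω : ∀ t, ⋀[ℝ]^2 (E (c t))} (hΩ : ∀ t, HasCovDerivAlongAt₂ nabla c Ω t 0)
    {ξ η : ∀ t, E (c t)} (hξ : IsParallelAlong nabla c ξ) (hη : IsParallelAlong nabla c η)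
    (t t' : ℝ) :
    inner ℝ (Ω t) (wedge (ξ t) (η t)) = inner ℝ (Ω t') (wedge (ξ t') (η t')) := by
  have h (t : ℝ) : HasDerivAt (fun τ => inner ℝ (Ω τ) (wedge (ξ τ) (η τ))) 0 t := by
    simpa using (hΩ t).hasDerivAt_inner_wedge hmetric (hc t) (hξ t) (hη t)
  exact is_const_of_deriv_eq_zero (fun t => (h t).differentiableAt) (fun t => (h t).deriv) t t'

theorem mdifferentiable_curveX : MDifferentiable 𝓘(ℝ, ℝ) IT curveX := by
  have h : MDifferentiable 𝓘(ℝ, ℝ) (𝓡 1) Circle.exp :=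
    (contMDiff_circleExp (m := 1)).mdifferentiable (by simp)
  have h' : MDifferentiable 𝓘(ℝ, ℝ) (𝓡 1) fun _ : ℝ => Circle.exp 0 := mdifferentiable_const
  exact h.prodMk h'

theorem mdifferentiable_curveY : MDifferentiable 𝓘(ℝ, ℝ) IT curveY := by
  have h : MDifferentiable 𝓘(ℝ, ℝ) (𝓡 1) Circle.exp :=
    (contMDiff_circleExp (m := 1)).mdifferentiable (by simp)
  have h' : MDifferentiable 𝓘(ℝ, ℝ) (𝓡 1) fun _ : ℝ => Circle.exp 0 := mdifferentiable_const
  exact h'.prodMk h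

end Bundle

/-! ### Bivectors as matrices of quaternion multiplications -/

section Bivector

variable {V : Type*} [NormedAddCommGroup V] [InnerProductSpace ℝ V]

theorem wedge_sum_smul {ι : Type*} [Fintype ι] (x y : ι → ℝ) (e : ι → V) :
    wedge (∑ a, x a • e a) (∑ b, y b • e b) = ∑ a, ∑ b, (x a * y b) • wedge (e a) (e b) := by
  have h1 (z : V) : wedge (∑ a, x a • e a) z = ∑ a, x a • wedge (e a) z := by
    let L : V →ₗ[ℝ] ⋀[ℝ]^2 V := (exteriorPower.ιMulti ℝ 2).toMultilinearMap.toLinearMap ![0, z] 0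
    have hL (u : V) : L u = wedge u z := by
      simp only [L, MultilinearMap.toLinearMap_apply, wedge]
      refine congrArg _ (funext fun i => ?_)
      fin_cases i <;> rfl
    simp only [← hL, map_sum, map_smul]
  have h2 (z : V) : wedge z (∑ b, y b • e b) = ∑ b, y b • wedge z (e b) := by
    let L : V →ₗ[ℝ] ⋀[ℝ]^2 V := (exteriorPower.ιMulti ℝ 2).toMultilinearMap.toLinearMap ![z, 0] 1
    have hL (u : V) : L u = wedge z u := by
      simp only [L, MultilinearMap.toLinearMap_apply, wedge]
      refine congrArg _ (funext fun i => ?_)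
      fin_cases i <;> rfl
    simp only [← hL, map_sum, map_smul]
  simp only [h1, h2, Finset.smul_sum, smul_smul]

variable [FiniteDimensional ℝ V]

/-- The matrix of the inner products of a bivector with the bivectors `vᵢ ∧ vⱼ`. -/
def bivectorMatrix (v : Fin 4 → V) : ⋀[ℝ]^2 V →ₗ[ℝ] Matrix (Fin 4) (Fin 4) ℝ where
  toFun w := Matrix.of fun i j => inner ℝ w (wedge (v i) (v j))
  map_add' w w' := by ext i j; simp [inner_add_left]
  map_smul' r w := by ext i j; simp [real_inner_smul_left]

theorem bivectorMatrix_apply (v : Fin 4 → V) (w : ⋀[ℝ]^2 V) (i j : Fin 4) :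
    bivectorMatrix v w i j = inner ℝ w (wedge (v i) (v j)) := rfl

theorem bivectorMatrix_of_eq_sum {v e : Fin 4 → V} {B : Matrix (Fin 4) (Fin 4) ℝ}
    (h : ∀ i, v i = ∑ a, B i a • e a) (w : ⋀[ℝ]^2 V) :
    bivectorMatrix v w = B * bivectorMatrix e w * Bᵀ := by
  ext i j
  simp only [bivectorMatrix_apply, h, wedge_sum_smul, inner_sum, real_inner_smul_right,
    Matrix.mul_apply, Matrix.transpose_apply, Finset.sum_mul]
  rw [Finset.sum_comm]
  exact Finset.sum_congr rfl fun a _ => Finset.sum_congr rfl fun b _ => by ring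

theorem bivectorMatrix_injective (v : OrthonormalBasis (Fin 4) ℝ V) :
    Function.Injective (bivectorMatrix v) := by
  rw [injective_iff_map_eq_zero]
  intro w hw
  have h : innerₗ (⋀[ℝ]^2 V) w = 0 := by
    refine (v.toBasis.exteriorPower 2).ext fun s => ?_
    rw [exteriorPower.basis_apply, exteriorPower.ιMulti_family]
    have := congrFun (congrFun hw (Set.powersetCard.ofFinEmbEquiv.symm s 0))
      (Set.powersetCard.ofFinEmbEquiv.symm s 1)
    rw [bivectorMatrix_apply] at this
    rw [LinearMap.zero_apply, innerₗ_apply_apply]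
    refine Eq.trans (congrArg _ (congrArg _ (funext fun i => ?_))) this
    fin_cases i <;> simp
  exact inner_self_eq_zero.1 (congrArg (fun L => L w) h)

/-- The matrices of the self-dual (`ε = 1`) or anti-self-dual (`ε = -1`) bivectors, as matrices of
left or right multiplications. -/
def dualMatrix (ε : ℤˣ) : ℍ[ℝ] →ₗ[ℝ] Matrix (Fin 4) (Fin 4) ℝ where
  toFun q := if ε = 1 then leftMatrix q else rightMatrix q
  map_add' x y := by
    split_ifs <;> ext i j <;> fin_cases i <;> fin_cases j <;>
      simp [leftMatrix, rightMatrix] <;> ring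
  map_smul' r x := by
    split_ifs <;> ext i j <;> fin_cases i <;> fin_cases j <;>
      simp [leftMatrix, rightMatrix]

theorem dualMatrix_one (q : ℍ[ℝ]) : dualMatrix 1 q = leftMatrix q := rfl

theorem dualMatrix_neg_one (q : ℍ[ℝ]) : dualMatrix (-1) q = rightMatrix q := rfl

theorem dualMatrix_injective (ε : ℤˣ) : Function.Injective (dualMatrix ε) := by
  intro x y h
  have e (i : Fin 4) := congrFun (congrFun h i) 0
  rcases Int.units_eq_one_or ε with rfl | rfl
  · ext
    exacts [e 0, e 1, e 2, e 3]
  · ext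
    exacts [e 0, neg_injective (e 1), neg_injective (e 2), neg_injective (e 3)]

/-- The unit quaternion that determines the action of `leftMatrix a * rightMatrix b` on
(anti-)self-dual bivectors. -/
def dualPart (ε : ℤˣ) (a b : ℍ[ℝ]) : ℍ[ℝ] := if ε = 1 then a else b

theorem sandwich_conj_dualMatrix (ε : ℤˣ) {a b : ℍ[ℝ]} (ha : normSq a = 1) (hb : normSq b = 1)
    (x : ℍ[ℝ]) :
    leftMatrix a * rightMatrix b * dualMatrix ε x * (leftMatrix a * rightMatrix b)ᵀ =
      dualMatrix ε (dualPart ε a b * x * star (dualPart ε a b)) := by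
  rcases Int.units_eq_one_or ε with rfl | rfl
  · exact sandwich_conj_leftMatrix hb x
  · exact sandwich_conj_rightMatrix ha x

theorem bivectorMatrix_wedge (e : OrthonormalBasis (Fin 4) ℝ V) (a b i j : Fin 4) :
    bivectorMatrix e (wedge (e a) (e b)) i j =
      (if a = i then 1 else 0) * (if b = j then 1 else 0) -
        (if a = j then 1 else 0) * (if b = i then 1 else 0) := by
  simp only [bivectorMatrix_apply, inner_wedge, e.inner_eq_ite]

/-- The frame corresponds to i, j, k up to a common factor; the sign -ε reflects the opposite signs
of the first rows of `leftMatrix` and `rightMatrix`. -/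
theorem bivectorMatrix_twistorFrame (ε : ℤˣ) (e : OrthonormalBasis (Fin 4) ℝ V) (k : Fin 3) :
    bivectorMatrix e (twistorFrame ε e k) =
      dualMatrix ε (pureQuat (Pi.single k (-((ε : ℤ) : ℝ) * (1 / √2)))) := by
  rcases Int.units_eq_one_or ε with rfl | rfl
  · rw [dualMatrix_one]
    ext i j
    fin_cases k <;> fin_cases i <;> fin_cases j <;>
      simp [twistorFrame, bivectorMatrix_wedge, leftMatrix]
  · rw [dualMatrix_neg_one]
    ext i j
    fin_cases k <;> fin_cases i <;> fin_cases j <;>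
      simp [twistorFrame, bivectorMatrix_wedge, rightMatrix]

/-- Two positively oriented orthonormal bases differ by a rotation, hence by a sandwich, and
conjugation by a sandwich preserves the multiplications by pure quaternions on either side. -/
theorem exists_bivectorMatrix_eq_dualMatrix {o : Orientation ℝ V (Fin 4)} {ε : ℤˣ}
    {v : OrthonormalBasis (Fin 4) ℝ V} (hv : v.toBasis.orientation = o) {w : ⋀[ℝ]^2 V}
    (hw : w ∈ selfDual o ε) : ∃ x, bivectorMatrix v w = dualMatrix ε (pureQuat x) := by
  suffices h : selfDual o ε ≤
      (LinearMap.range (dualMatrix ε ∘ₗ pureQuat)).comap (bivectorMatrix v) by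
    obtain ⟨x, hx⟩ := h hw
    exact ⟨x, hx.symm⟩
  rw [selfDual, Submodule.span_le]
  rintro - ⟨e, he, k, rfl⟩
  obtain ⟨B, hB⟩ : ∃ B, B = e.toBasis.toMatrix v := ⟨_, rfl⟩
  have hdet : Bᵀ.det = 1 := by
    rw [Matrix.det_transpose, hB]
    exact e.det_to_matrix_orthonormalBasis_of_same_orientation v (he.trans hv.symm)
  have horth : Bᵀᵀ * Bᵀ = 1 := by
    rw [Matrix.transpose_transpose, hB]
    exact e.toMatrix_orthonormalBasis_self_mul_conjTranspose v
  obtain ⟨a, b, ha, hb, hab⟩ := isSandwich_of_det_eq_one horth hdet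
  have hve (i : Fin 4) : v i = ∑ c, Bᵀ i c • e c := by
    rw [← e.toBasis.sum_toMatrix_smul_self v i, hB]
    simp
  rw [SetLike.mem_coe, Submodule.mem_comap]
  rw [bivectorMatrix_of_eq_sum hve, bivectorMatrix_twistorFrame, hab,
    sandwich_conj_dualMatrix ε ha hb, conj_pureQuat]
  exact ⟨_, rfl⟩

/-- The columns of `W` are the quaternion coordinates of the w_k; linear independence of w makes it
invertible. -/
theorem IsOrientedTwistorBasis.exists_matrix {o : Orientation ℝ V (Fin 4)} {ε : ℤˣ}
    {w : Fin 3 → ⋀[ℝ]^2 V} (hw : IsOrientedTwistorBasis o ε w)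
    {v : OrthonormalBasis (Fin 4) ℝ V} (hv : v.toBasis.orientation = o) :
    ∃ W : Matrix (Fin 3) (Fin 3) ℝ, W.det ≠ 0 ∧
      ∀ x : Fin 3 → ℝ, bivectorMatrix v (∑ k, x k • w k) = dualMatrix ε (pureQuat (W *ᵥ x)) := by
  choose n hn using fun k => exists_bivectorMatrix_eq_dualMatrix hv (hw.mem k)
  have key (x : Fin 3 → ℝ) : bivectorMatrix v (∑ k, x k • w k) =
      dualMatrix ε (pureQuat ((Matrix.of n)ᵀ *ᵥ x)) := by
    have : (Matrix.of n)ᵀ *ᵥ x = ∑ k, x k • n k := by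
      ext i
      simp [Matrix.mulVec, dotProduct, mul_comm]
    simp only [this, map_sum, map_smul, hn]
  refine ⟨(Matrix.of n)ᵀ, fun h0 => ?_, key⟩
  obtain ⟨x, hx, hx0⟩ := Matrix.exists_mulVec_eq_zero_iff.2 h0
  refine hx ?_
  have h1 := key x
  rw [hx0, map_zero, map_zero] at h1
  have h2 := bivectorMatrix_injective v (h1.trans (map_zero _).symm)
  exact funext (Fintype.linearIndependent_iff.1 hw.orthonormal.linearIndependent x h2)

end Bivector

/-! ### From the monodromy of E to conjugations by quaternions -/

section Monodromy

variable {E : Torus → Type*} [∀ b, NormedAddCommGroup (E b)] [∀ b, InnerProductSpace ℝ (E b)]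
  [∀ b, FiniteDimensional ℝ (E b)]

/-- Transfers pairings between fibres identified only by an equality of base points, as in
`HasMonodromy`. -/
theorem inner_wedge_congr {b b' : Torus} {w : ⋀[ℝ]^2 (E b)} {w' : ⋀[ℝ]^2 (E b')} {x y : E b}
    {x' y' : E b'} (hw : (⟨b, w⟩ : Σ b, ⋀[ℝ]^2 (E b)) = ⟨b', w'⟩)
    (hx : (⟨b, x⟩ : Σ b, E b) = ⟨b', x'⟩) (hy : (⟨b, y⟩ : Σ b, E b) = ⟨b', y'⟩) :
    inner ℝ w (wedge x y) = inner ℝ w' (wedge x' y') := by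
  cases hw
  cases hx
  cases hy
  rfl

variable [TopologicalSpace (Bundle.TotalSpace R4 E)]
  [FiberBundle R4 E] [VectorBundle ℝ R4 E] [ContMDiffVectorBundle ∞ R4 E IT]
  [IsContMDiffRiemannianBundle IT ∞ R4 E]

/-- The monodromy of the bundle of bivectors is induced by the monodromy of the bundle. -/
theorem bivectorMatrix_monodromy {nabla : CovariantDerivative IT R4 E}
    (hmetric : nabla.IsMetricCompatible) {c : ℝ → Torus} (hc : MDifferentiable 𝓘(ℝ, ℝ) IT c)
    {Ω : Fin 3 → ∀ t, ⋀[ℝ]^2 (E (c t))} (hΩ : ∀ k t, HasCovDerivAlongAt₂ nabla c (Ω k) t 0)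
    {ξ : Fin 4 → ∀ t, E (c t)} (hξ : ∀ i, IsParallelAlong nabla c (ξ i))
    {C : Matrix (Fin 3) (Fin 3) ℝ} (hC : HasMonodromy (G := fun b => ⋀[ℝ]^2 (E b)) Ω C)
    {A : Matrix.specialOrthogonalGroup (Fin 4) ℝ} (hA : HasMonodromy ξ A.1) (k : Fin 3) :
    A.1 * bivectorMatrix (fun i => ξ i 0) (Ω k 0) * A.1ᵀ =
      bivectorMatrix (fun i => ξ i 0) (∑ l, C l k • Ω l 0) := by
  -- The pairings of Ω_k with ξ_i ∧ ξ_j agree at times 0 and 2π, and the monodromies rewrite those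
  -- at 2π in the frames at 0.
  have h : bivectorMatrix (fun i => ξ i 0) (Ω k 0) =
      bivectorMatrix (fun i => ∑ a, A.1ᵀ i a • ξ a 0) (∑ l, C l k • Ω l 0) := by
    ext i j
    rw [bivectorMatrix_apply, bivectorMatrix_apply,
      inner_wedge_eq_of_parallel hmetric hc (hΩ k) (hξ i) (hξ j) 0 (0 + 2 * π)]
    exact inner_wedge_congr (hC 0 k) (hA 0 i) (hA 0 j)
  rw [h, bivectorMatrix_of_eq_sum (fun _ => rfl), Matrix.transpose_transpose, mul_assoc, mul_assoc,
    specialOrthogonal_mul_transpose, mul_one, ← mul_assoc, specialOrthogonal_mul_transpose,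
    one_mul]

theorem isConjMatrix_of_monodromy {nabla : CovariantDerivative IT R4 E}
    (hmetric : nabla.IsMetricCompatible) {c : ℝ → Torus} (hc : MDifferentiable 𝓘(ℝ, ℝ) IT c)
    {Ω : Fin 3 → ∀ t, ⋀[ℝ]^2 (E (c t))} (hΩ : ∀ k t, HasCovDerivAlongAt₂ nabla c (Ω k) t 0)
    {ξ : Fin 4 → ∀ t, E (c t)} (hξ : ∀ i, IsParallelAlong nabla c (ξ i))
    {C : Matrix (Fin 3) (Fin 3) ℝ} (hC : HasMonodromy (G := fun b => ⋀[ℝ]^2 (E b)) Ω C)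
    {A : Matrix.specialOrthogonalGroup (Fin 4) ℝ} (hA : HasMonodromy ξ A.1)
    {W : Matrix (Fin 3) (Fin 3) ℝ} {ε : ℤˣ}
    (hW : ∀ x : Fin 3 → ℝ, bivectorMatrix (fun i => ξ i 0) (∑ k, x k • Ω k 0) =
      dualMatrix ε (pureQuat (W *ᵥ x)))
    {a b : ℍ[ℝ]} (ha : normSq a = 1) (hb : normSq b = 1)
    (hab : A.1 = leftMatrix a * rightMatrix b) : IsConjMatrix W (dualPart ε a b) C := by
  intro x
  apply dualMatrix_injective ε
  rw [← sandwich_conj_dualMatrix ε ha hb, ← hab, ← hW, ← hW, map_sum, Finset.mul_sum,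
    Finset.sum_mul]
  simp only [map_smul, Matrix.mul_smul, Matrix.smul_mul,
    bivectorMatrix_monodromy hmetric hc hΩ hξ hC hA, map_sum, Finset.smul_sum, smul_smul]
  rw [Finset.sum_comm]
  refine Finset.sum_congr rfl fun l _ => ?_
  rw [← Finset.sum_smul]
  congr 1
  exact Finset.sum_congr rfl fun k _ => mul_comm _ _

/-- Both families of parallel sections start from the same v and w, so one `W` serves both circles;
this makes the two axes comparable. -/
theorem exists_isConjMatrix {nabla : CovariantDerivative IT R4 E}
    (hmetric : nabla.IsMetricCompatible) {o : ∀ b, Orientation ℝ (E b) (Fin 4)} {ε : ℤˣ}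
    {C₁ C₂ : Matrix.specialOrthogonalGroup (Fin 3) ℝ} (hC : IsTwistorHolonomyPair nabla o ε C₁ C₂)
    {A₁ A₂ : Matrix.specialOrthogonalGroup (Fin 4) ℝ} (hA : IsHolonomyPair nabla o A₁ A₂)
    {a₁ b₁ a₂ b₂ : ℍ[ℝ]} (ha₁ : normSq a₁ = 1) (hb₁ : normSq b₁ = 1) (ha₂ : normSq a₂ = 1)
    (hb₂ : normSq b₂ = 1) (h₁ : A₁.1 = leftMatrix a₁ * rightMatrix b₁)
    (h₂ : A₂.1 = leftMatrix a₂ * rightMatrix b₂) :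
    ∃ W : Matrix (Fin 3) (Fin 3) ℝ, W.det ≠ 0 ∧ IsConjMatrix W (dualPart ε a₁ b₁) C₁.1 ∧
      IsConjMatrix W (dualPart ε a₂ b₂) C₂.1 := by
  obtain ⟨v, ξx, ξy, hv, hξx, hξy, hA₁, hA₂⟩ := hA
  obtain ⟨w, Ωx, Ωy, hw, hΩx, hΩy, hC₁, hC₂⟩ := hC
  obtain ⟨W, hW, hWw⟩ := hw.exists_matrix hv
  refine ⟨W, hW, ?_, ?_⟩
  · refine isConjMatrix_of_monodromy hmetric mdifferentiable_curveX
      (fun k t => ((hΩx k).1 t).2) (fun i => (hξx i).1) hC₁ hA₁ (fun x => ?_) ha₁ hb₁ h₁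
    rw [← hWw]
    simp only [(hξx _).2, (hΩx _).2]
  · refine isConjMatrix_of_monodromy hmetric mdifferentiable_curveY
      (fun k t => ((hΩy k).1 t).2) (fun i => (hξy i).1) hC₂ hA₂ (fun x => ?_) ha₂ hb₂ h₂
    rw [← hWw]
    simp only [(hξy _).2, (hΩy _).2]

end Monodromy

end TorusHolonomy

end

/-- `E` is a smooth oriented real vector bundle of rank `4` over the torus with a smooth metric, and
`nabla` is a smooth metric connection. The index `0`, `1` of `C ε`, `p ε` stands for the circle in the
first, second direction. -/
theorem theorem4p5
    {E : Torus → Type*} [TopologicalSpace (Bundle.TotalSpace R4 E)]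
    [∀ b, NormedAddCommGroup (E b)] [∀ b, InnerProductSpace ℝ (E b)]
    [∀ b, FiniteDimensional ℝ (E b)]
    [FiberBundle R4 E] [VectorBundle ℝ R4 E] [ContMDiffVectorBundle ∞ R4 E IT]
    [IsContMDiffRiemannianBundle IT ∞ R4 E]
    (o : ∀ b, Orientation ℝ (E b) (Fin 4)) (ho : IsBundleOrientation o)
    (nabla : CovariantDerivative IT R4 E)
    (hsmooth : CovariantDerivative.ContMDiffCovariantDerivative nabla ∞)
    (hmetric : nabla.IsMetricCompatible)
    (C : ℤˣ → Fin 2 → Matrix.specialOrthogonalGroup (Fin 3) ℝ)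
    (hC : ∀ ε, IsTwistorHolonomyPair nabla o ε (C ε 0) (C ε 1))
    (θ : ℤˣ → Fin 2 → ℝ) (p : ℤˣ → Fin 2 → EuclideanSpace ℝ (Fin 3))
    (hrot : ∀ ε k, IsRotation (C ε k) (θ ε k) (p ε k))
    (φ : ℤˣ → ℝ) (hφ : ∀ ε, φ ε = InnerProductGeometry.angle (p ε 0) (p ε 1))
    (hφ_mem : ∀ ε, φ ε ∈ Set.Ioc 0 (π / 2))
    (q₁ q₂ : ℚ) (hq₁ : ∀ n : ℤ, q₁ ≠ n) (hq₂ : ∀ n : ℤ, q₂ ≠ n)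
    (ψ₁ ψ₂ : ℝ) (hψ₁ : Irrational ψ₁) (hψ₂ : Irrational ψ₂)
    (hθ₁ : θ 1 0 = q₁ * π) (hθ₂ : θ 1 1 = ψ₂ * π)
    (hθ₃ : θ (-1) 0 = ψ₁ * π) (hθ₄ : θ (-1) 1 = q₂ * π)
    (G : Subgroup (Matrix.specialOrthogonalGroup (Fin 4) ℝ))
    (hG : IsTopHolonomyGroup nabla o G) :
    Dense (G : Set (Matrix.specialOrthogonalGroup (Fin 4) ℝ)) := by
  obtain ⟨A₁, A₂, hA, rfl⟩ := hG
  obtain ⟨a₁, b₁, ha₁, hb₁, h₁⟩ := isSandwich_of_det_eq_one (specialOrthogonal_transpose_mul A₁)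
    (Matrix.mem_specialOrthogonalGroup_iff.1 A₁.2).2
  obtain ⟨a₂, b₂, ha₂, hb₂, h₂⟩ := isSandwich_of_det_eq_one (specialOrthogonal_transpose_mul A₂)
    (Matrix.mem_specialOrthogonalGroup_iff.1 A₂.2).2
  obtain ⟨W, hW, hC₁, hC₂⟩ := exists_isConjMatrix hmetric (hC 1) hA ha₁ hb₁ ha₂ hb₂ h₁ h₂
  obtain ⟨W', hW', hD₁, hD₂⟩ := exists_isConjMatrix hmetric (hC (-1)) hA ha₁ hb₁ ha₂ hb₂ h₁ h₂
  let G := Subgroup.closure {A₁, A₂}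
  -- The closure is taken among all 4 × 4 matrices, where density of G means that every rotation
  -- lies in `H`.
  let H : Submonoid (Matrix (Fin 4) (Fin 4) ℝ) :=
    (G.toSubmonoid.map (Matrix.specialOrthogonalGroup (Fin 4) ℝ).subtype).topologicalClosure
  have hGH {A : Matrix.specialOrthogonalGroup (Fin 4) ℝ} (h : A ∈ G) : A.1 ∈ H :=
    subset_closure ⟨A, h, rfl⟩
  -- On G the transpose is the inverse, and continuity extends the stability to the closure.
  have htr : ∀ A ∈ H, A.transpose ∈ H := by
    refine fun A hA => map_mem_closure (continuous_id.matrix_transpose) hA ?_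
    rintro - ⟨B, hB, rfl⟩
    exact ⟨B⁻¹, G.inv_mem hB, rfl⟩
  rw [Subtype.dense_iff]
  intro A hA'
  have hrot₁ := hrot 1 0
  have hrot₂ := hrot 1 1
  have hrot₃ := hrot (-1) 0
  have hrot₄ := hrot (-1) 1
  rw [hθ₁] at hrot₁
  rw [hθ₂] at hrot₂
  rw [hθ₃] at hrot₃
  rw [hθ₄] at hrot₄
  exact mem_of_isRotation_pairs (H := H) (Submonoid.isClosed_topologicalClosure _) htr ha₁ hb₁ ha₂
    hb₂ (h₁ ▸ hGH (Subgroup.subset_closure (by simp))) (h₂ ▸ hGH (Subgroup.subset_closure (by simp)))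
    hW hW' hC₁ hC₂ hD₁ hD₂ hq₁ hq₂ hψ₁ hψ₂ hrot₁ hrot₂ hrot₃ hrot₄ (hφ 1 ▸ hφ_mem 1)
    (hφ (-1) ▸ hφ_mem (-1)) (specialOrthogonal_transpose_mul ⟨A, hA'⟩)
    (Matrix.mem_specialOrthogonalGroup_iff.1 hA').2
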